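/- Let $n\ge 3$ and let $\omega_{n-1}$ be the area of the unit sphere in $\mathbb{R}^n$, with standard metric $g_0$. Let $\mathrm{RotSym}^\partial_n$ be the class of complete, rotationally symmetric, smooth Riemannian $n$-manifolds $M$ of nonnegative scalar curvature whose connected nonempty boundary is an outermost and outer-minimizing minimal hypersurface. In geodesic coordinates, $M=[0,\infty)\times S^{n-1}$ with $g=ds^2+r(s)^2g_0$, where $s$ is the distance to $\partial M$ and $r>0$ is smooth. The symmetric sphere $\{s\}\times S^{n-1}$ has area $\omega_{n-1}r(s)^{n-1}$, and $m_{\mathrm{ADM}}(M)=\lim_{s\to\infty}\tfrac12 r^{n-2}\bigl(1-(dr/ds)^2\bigr)$. For $m>0$ and $L\ge 0$ let $M_{\mathrm{Sch}}(m,L)$ be the Schwarzschild space $[(2m)^{1/(n-2)},\infty)\times S^{n-1}$ with metric $(1-2m\rho^{2-n})^{-1}d\rho^2+\rho^2g_0$, with the round cylinder of length $L$ and radius $(2m)^{1/(n-2)}$ glued to its boundary. For $M\in\mathrm{RotSym}^\partial_n$ of finite ADM mass set $m_0=\frac12\left(\frac{|\partial M|}{\omega_{n-1}}\right)^{\frac{n-2}{n-1}}$,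 define $\delta_M$ by $m_{\mathrm{ADM}}=(1+\delta_M)m_0$, and let $r_{\delta_M}=(1+\sqrt{\delta_M})^{1/(n-2)}r(0)$. Embed $M$ in $\mathbb{R}^{n+1}$ as a rotationally symmetric graph whose height $z$ increases with $r$, with $(dz/dr)^2=(ds/dr)^2-1$, normalized so that at $r=r_{\delta_M}$ it meets the Schwarzschild graph given by $dz/dr=\sqrt{2m_0/(r^{n-2}-2m_0)}$, $z=0$ on the horizon. The depth $L$ of $M$ is minus the height of $\partial M$. For metric spaces $X,Y$ the Lipschitz distance $d_{\mathcal L}(X,Y)$ is the infimum of $|\log\operatorname{dil}\varphi|+|\log\operatorname{dil}\varphi^{-1}|$ over bi-Lipschitz bijections $\varphi:X\to Y$ (infinite if there are none), where $\operatorname{dil}\varphi=\sup_{x_1\ne x_2}d_Y(\varphi(x_1),\varphi(x_2))/d_X(x_1,x_2)$. Write $T_D(\Sigma)$ for the closed tubular neighborhood $\{p: d(p,\Sigma)\le D\}$. **Proposition.** Let $n\ge3$ and $0<A_0<A_1$. For any $D>0$ and $\varepsilon>0$ there exists $\delta>0$ such that for every $M\in\mathrm{RotSym}^\partial_n$ with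 $|\partial M|=A_0$ and $$m_{\mathrm{ADM}}<\frac{1+\delta}{2}\left(\frac{A_0}{\omega_{n-1}}\right)^{\frac{n-2}{n-1}}$$ that contains a symmetric sphere $\Sigma_1$ of area $A_1$ (as it does when $M$ is asymptotically flat), we have $$d_{\mathcal L}\bigl(T_D(\Sigma_1)\subset M,\; T_D(\bar\Sigma_1)\subset M_{\mathrm{Sch}}(m_0,L)\bigr)<\varepsilon,$$ where $L$ is the depth of $M$ and $\bar\Sigma_1$ is the symmetric sphere of area $A_1$ in $M_{\mathrm{Sch}}(m_0,L)$. This holds both when the tubular neighborhoods carry the restrictions of the Riemannian distances of the ambient spaces and when they carry their own intrinsic (length) distances. -/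

import Mathlib

open Set Filter Topology MeasureTheory
open scoped ENNReal ContDiff

noncomputable section

/-! ### Lipschitz distance -/

/-- The dilatation `sup d_Y(φ x₁, φ x₂) / d_X(x₁, x₂)` over pairs of distinct points. -/
def dil {X Y : Type*} (dX : X → X → ℝ≥0∞) (dY : Y → Y → ℝ≥0∞) (φ : X → Y) : ℝ≥0∞ :=
  ⨆ (x₁ : X) (x₂ : X) (_ : x₁ ≠ x₂), dY (φ x₁) (φ x₂) / dX x₁ x₂

/-- The Lipschitz distance between `(X, dX)` and `(Y, dY)`: the infimum of
`|log dil φ| + |log dil φ⁻¹|` over all bi-Lipschitz bijections `φ : X → Y`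
(it is `∞` if there are none). -/
def lipschitzDist {X Y : Type*} (dX : X → X → ℝ≥0∞) (dY : Y → Y → ℝ≥0∞) : ℝ≥0∞ :=
  ⨅ (φ : X ≃ Y) (_ : dil dX dY φ ≠ ⊤ ∧ dil dY dX φ.symm ≠ ⊤),
    ENNReal.ofReal
      (|Real.log (dil dX dY φ).toReal| + |Real.log (dil dY dX φ.symm).toReal|)

/-! ### Scalar curvature in coordinates -/

/-- The partial derivative `∂ₖ f` at `x`. -/
def partialDeriv {n : ℕ} (k : Fin n) (f : EuclideanSpace ℝ (Fin n) → ℝ)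
    (x : EuclideanSpace ℝ (Fin n)) : ℝ :=
  fderiv ℝ f x (EuclideanSpace.single k 1)

/-- The Christoffel symbol `Γᵏᵢⱼ` of the metric with coefficients `g`. -/
def christoffel {n : ℕ} (g : EuclideanSpace ℝ (Fin n) → Matrix (Fin n) (Fin n) ℝ)
    (k i j : Fin n) (x : EuclideanSpace ℝ (Fin n)) : ℝ :=
  (1 / 2) * ∑ l, (g x)⁻¹ k l *
    (partialDeriv i (fun y => g y j l) x + partialDeriv j (fun y => g y i l) x
      - partialDeriv l (fun y => g y i j) x)

/-- The component `Ricⱼₖ` of the Ricci curvature of the metric with coefficients `g`. -/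
def ricci {n : ℕ} (g : EuclideanSpace ℝ (Fin n) → Matrix (Fin n) (Fin n) ℝ)
    (j k : Fin n) (x : EuclideanSpace ℝ (Fin n)) : ℝ :=
  ∑ i, (partialDeriv i (christoffel g i j k) x - partialDeriv j (christoffel g i i k) x
    + ∑ l, (christoffel g i i l x * christoffel g l j k x
      - christoffel g i j l x * christoffel g l i k x))

/-- The scalar curvature of the metric with coefficients `g`. -/
def scalarCurvature {n : ℕ} (g : EuclideanSpace ℝ (Fin n) → Matrix (Fin n) (Fin n) ℝ)
    (x : EuclideanSpace ℝ (Fin n)) : ℝ :=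
  ∑ j, ∑ k, (g x)⁻¹ j k * ricci g j k x

/-- The coefficients of the metric `ds² + r(s)² g₀` on `[0, ∞) × Sⁿ⁻¹` in the global chart
`(s, θ) ↦ x = (1 + s) θ` onto `{x ∈ ℝⁿ : ‖x‖ ≥ 1}`; there `s = ‖x‖ - 1`, `ds = ⟨x, dx⟩ / ‖x‖` and
`g₀ = ‖x‖⁻² (|dx|² - ds²)`. -/
def rotMetricCoeff {n : ℕ} (r : ℝ → ℝ) (x : EuclideanSpace ℝ (Fin n)) :
    Matrix (Fin n) (Fin n) ℝ :=
  fun i j => x i * x j / ‖x‖ ^ 2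
    + (r (‖x‖ - 1) / ‖x‖) ^ 2 * ((if i = j then 1 else 0) - x i * x j / ‖x‖ ^ 2)

/-! ### Rotationally symmetric spaces `[s₀, ∞) × Sⁿ⁻¹` and their distances -/

/-- The area `ω_{n-1}` of the unit sphere in `ℝⁿ`. -/
def unitSphereArea (n : ℕ) : ℝ :=
  ((volume : Measure (EuclideanSpace ℝ (Fin n))).toSphere univ).toReal

/-- The data of the space `[start, ∞) × Sⁿ⁻¹` with the metric `ds² + radius(s)² g₀`, where `g₀` is
the standard metric of the unit sphere. -/
structure WarpedCylinder where
  start : ℝ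
  radius : ℝ → ℝ

namespace WarpedCylinder

variable (N : WarpedCylinder) (n : ℕ)

/-- The underlying set of points `(s, θ)`, `s ≥ start`, `θ` in the unit sphere of `ℝⁿ`. -/
def carrier : Set (ℝ × EuclideanSpace ℝ (Fin n)) :=
  {p | N.start ≤ p.1 ∧ ‖p.2‖ = 1}

variable {n}

/-- The length of a curve `u ↦ (s(u), θ(u))`, `0 ≤ u ≤ 1`, in the metric `ds² + radius(s)² g₀`. -/
def length (γ : ℝ → ℝ × EuclideanSpace ℝ (Fin n)) : ℝ≥0∞ :=
  ∫⁻ u in Icc (0 : ℝ) 1, ENNReal.ofReal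
    (√((deriv (fun v => (γ v).1) u) ^ 2
      + (N.radius (γ u).1) ^ 2 * ‖deriv (fun v => (γ v).2) u‖ ^ 2))

/-- The infimum of the lengths of the `C¹` curves from `p` to `q` that stay in `U`.
For `U` the whole space this is the Riemannian distance; for a subset `U` it is the
intrinsic (length) distance of `U`. -/
def distIn (U : Set (ℝ × EuclideanSpace ℝ (Fin n))) (p q : ℝ × EuclideanSpace ℝ (Fin n)) :
    ℝ≥0∞ :=
  ⨅ (γ : ℝ → ℝ × EuclideanSpace ℝ (Fin n))
    (_ : ContDiffOn ℝ 1 γ (Icc 0 1) ∧ MapsTo γ (Icc 0 1) U ∧ γ 0 = p ∧ γ 1 = q), N.length γ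

/-- The Riemannian distance. -/
def rdist (p q : ℝ × EuclideanSpace ℝ (Fin n)) : ℝ≥0∞ := N.distIn (N.carrier n) p q

variable (n)

/-- The area `ω_{n-1} radius(s)ⁿ⁻¹` of the symmetric sphere `{s} × Sⁿ⁻¹`. -/
def sphereArea (s : ℝ) : ℝ := unitSphereArea n * N.radius s ^ (n - 1)

/-- The symmetric sphere of area `A`, as a set of points. -/
def symmetricSphere (A : ℝ) : Set (ℝ × EuclideanSpace ℝ (Fin n)) :=
  {p | p ∈ N.carrier n ∧ N.sphereArea n p.1 = A}

variable {n}

/-- The closed tubular neighbourhood `{p : d(p, S) ≤ D}`. -/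
def tube (D : ℝ) (S : Set (ℝ × EuclideanSpace ℝ (Fin n))) :
    Set (ℝ × EuclideanSpace ℝ (Fin n)) :=
  {p | p ∈ N.carrier n ∧ (⨅ q ∈ S, N.rdist p q) ≤ ENNReal.ofReal D}

/-- The Lipschitz distance between `T ⊆ N` and `T' ⊆ N'`, both with the restrictions of the
Riemannian distances of the ambient spaces. -/
def restrictedLipDist (N N' : WarpedCylinder) (T T' : Set (ℝ × EuclideanSpace ℝ (Fin n))) :
    ℝ≥0∞ :=
  lipschitzDist (fun p q : T => N.rdist p.1 q.1) (fun p q : T' => N'.rdist p.1 q.1)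

/-- The Lipschitz distance between `T ⊆ N` and `T' ⊆ N'`, both with their own intrinsic
(length) distances. -/
def intrinsicLipDist (N N' : WarpedCylinder) (T T' : Set (ℝ × EuclideanSpace ℝ (Fin n))) :
    ℝ≥0∞ :=
  lipschitzDist (fun p q : T => N.distIn T p.1 q.1) (fun p q : T' => N'.distIn T' p.1 q.1)

end WarpedCylinder

/-! ### Appended Schwarzschild spaces -/

/-- The radius `(2m)^{1/(n-2)}` of the horizon. -/
def horizonRadius (n : ℕ) (m : ℝ) : ℝ := (2 * m) ^ (((n : ℝ) - 2)⁻¹)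

/-- The distance from the horizon to the sphere of radius `ρ` in the Schwarzschild metric
`(1 - 2m / ρⁿ⁻²)⁻¹ dρ² + ρ² g₀`. -/
def schwarzschildArclength (n : ℕ) (m ρ : ℝ) : ℝ :=
  ∫ t in (horizonRadius n m)..ρ, (√(1 - 2 * m / t ^ (n - 2)))⁻¹

/-- The radius of the sphere at distance `s ≥ 0` from the horizon: the inverse of
`schwarzschildArclength n m : [horizonRadius n m, ∞) → [0, ∞)`. -/
def schwarzschildRadius (n : ℕ) (m s : ℝ) : ℝ :=
  Function.invFunOn (schwarzschildArclength n m) (Ici (horizonRadius n m)) s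

/-- The Schwarzschild space of mass `m` outside its horizon (placed at `s = 0`), with the round
cylinder `[-L, 0] × Sⁿ⁻¹` over the horizon glued to it. -/
def appendedSchwarzschild (n : ℕ) (m L : ℝ) : WarpedCylinder where
  start := -L
  radius := fun s => if s ≤ 0 then horizonRadius n m else schwarzschildRadius n m s

/-- The height `z(ρ)` of the Schwarzschild space as a rotationally symmetric graph in `ℝⁿ⁺¹`,
with its horizon at height `0`: `dz/dρ = √(2m / (ρⁿ⁻² - 2m))`. -/
def schwarzschildHeight (n : ℕ) (m ρ : ℝ) : ℝ :=
  ∫ t in (horizonRadius n m)..ρ, √(2 * m / (t ^ (n - 2) - 2 * m))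

/-! ### The class of rotationally symmetric manifolds -/

/-- Complete rotationally symmetric smooth `n`-manifolds with boundary, in geodesic coordinates:
`[0, ∞) × Sⁿ⁻¹` with the metric `ds² + r(s)² g₀`, `s` being the distance to the boundary, with
nonnegative scalar curvature and with an outermost and outer-minimizing minimal boundary.
The unit-speed normal flow of a symmetric sphere runs through symmetric spheres, so that a sphere
is minimal when the derivative of the area vanishes. Only symmetric spheres are used to test
that the boundary is outermost and outer-minimizing; this asks least of the manifold. -/
structure RotSymBdry (n : ℕ) where
  r : ℝ → ℝ
  smooth : ContDiffOn ℝ ∞ r (Ici 0)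
  pos : ∀ s, 0 ≤ s → 0 < r s
  scalarCurvature_nonneg : ∀ x : EuclideanSpace ℝ (Fin n), 1 < ‖x‖ →
    0 ≤ scalarCurvature (rotMetricCoeff r) x
  boundary_minimal :
    derivWithin (WarpedCylinder.sphereArea ⟨0, r⟩ n) (Ici 0) 0 = 0
  boundary_outermost : ∀ s, 0 < s →
    derivWithin (WarpedCylinder.sphereArea ⟨0, r⟩ n) (Ici 0) s ≠ 0
  boundary_outerMinimizing : ∀ s, 0 < s →
    WarpedCylinder.sphereArea ⟨0, r⟩ n 0 ≤ WarpedCylinder.sphereArea ⟨0, r⟩ n s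

namespace RotSymBdry

variable {n : ℕ} (M : RotSymBdry n)

/-- The underlying space. -/
def space : WarpedCylinder := ⟨0, M.r⟩

/-- The area `|∂M|` of the boundary. -/
def boundaryArea : ℝ := M.space.sphereArea n 0

/-- The Hawking mass of the symmetric sphere at distance `s` from the boundary. -/
def hawkingMass (s : ℝ) : ℝ := M.r s ^ (n - 2) / 2 * (1 - deriv M.r s ^ 2)

/-- `m` is the (finite) ADM mass: the limit of the Hawking masses. -/
def HasADMMass (m : ℝ) : Prop := Tendsto M.hawkingMass atTop (𝓝 m)

/-- `m₀ = (1/2) (|∂M| / ω_{n-1})^{(n-2)/(n-1)}`. -/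
def boundaryMass : ℝ :=
  (1 / 2) * (M.boundaryArea / unitSphereArea n) ^ (((n : ℝ) - 2) / ((n : ℝ) - 1))

/-- The radius `r_δ = (1 + √δ)^{1/(n-2)} r(0)`, where `m = (1 + δ) m₀` is the ADM mass. -/
def matchingRadius (m : ℝ) : ℝ :=
  (1 + √(m / M.boundaryMass - 1)) ^ (((n : ℝ) - 2)⁻¹) * M.r 0

/-- The rise in height between the boundary and the sphere at distance `s` from it when `M` is
embedded in `ℝⁿ⁺¹` as a rotationally symmetric graph with increasing height `z`. As
`(dz/dr)² = (ds/dr)² - 1`, one has `dz/ds = √(1 - (dr/ds)²)`. -/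
def rise (s : ℝ) : ℝ := ∫ t in (0 : ℝ)..s, √(1 - deriv M.r t ^ 2)

/-- The depth of a manifold with ADM mass `m`: the number `L` for which the embedded graph whose
boundary has height `-L` meets the standard embedding of the Schwarzschild space of mass `m₀`
(with horizon at height `0`) at the sphere of radius `r_δ`. -/
def depth (m : ℝ) : ℝ :=
  M.rise (Function.invFunOn M.r (Ici 0) (M.matchingRadius m))
    - schwarzschildHeight n M.boundaryMass (M.matchingRadius m)

end RotSymBdry

end

/-! Nonnegative scalar curvature makes the Hawking mass nondecreasing in `s`
(`hawkingMass_monotoneOn`). It starts at `m₀` because the boundary is minimal, and it tends to `m =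
(1 + e²) m₀`, where `e = √δ_M`. Hence `r'` is squeezed: `1 - 2m / rⁿ⁻² ≤ r'² ≤ 1 - 2m₀ / rⁿ⁻²`.

Let `A(ρ)` be the Schwarzschild distance from the horizon to radius `ρ`. The function `A ∘ r` has
slope at most 1 everywhere, and slope at least `√(1 - e)` where `r ≥ r_δ` (`arclength_r_sub_le`,
`le_arclength_r_sub`). So outside the sphere of radius `r_δ`, bounded pieces of `M` and of
Schwarzschild space have nearly the same radius function. Inside that sphere the radii of both lie
between `r(0)` and `r_δ`, which is close to `r(0)`; both are nearly round cylinders, of possibly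
huge length. The depth `L` agrees with the distance from `∂M` to that sphere up to `2 A(r_δ)`: on a
nearly vertical graph, height and arclength almost agree. Thus the distances from the two spheres of
area `A₁` to the boundaries also nearly agree. This is `areClose`, whose error depends only on `n`,
`A₀`, `A₁`, `D` and `e`, not on the depth.

An affine stretching of the radial coordinate then maps one tube onto the other, and it multiplies
lengths by at most a factor `K` near 1 in both directions (`AreClose.distIn_le`). Curves realizing
ambient distances may leave the tube, so for those distances the stretching is extended to the whole
space: by translation towards the boundary and by collapsing the outside. The extension is only
Lipschitz, while distances are defined by `C¹` curves, so it is approximated by `C¹` maps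
(`distIn_strip_map_le`). -/

noncomputable section

/-! ### Scalar curvature of rotationally symmetric metrics -/

/-- `f` is differentiable at `x` with partial derivatives `d`. -/
def HasPartials {n : ℕ} (f : EuclideanSpace ℝ (Fin n) → ℝ) (d : Fin n → ℝ)
    (x : EuclideanSpace ℝ (Fin n)) : Prop :=
  ∃ f' : EuclideanSpace ℝ (Fin n) →L[ℝ] ℝ, HasFDerivAt f f' x ∧
    ∀ k, f' (EuclideanSpace.single k 1) = d k

namespace HasPartials

variable {n : ℕ} {f g : EuclideanSpace ℝ (Fin n) → ℝ} {d e : Fin n → ℝ}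
  {x : EuclideanSpace ℝ (Fin n)}

theorem partialDeriv (h : HasPartials f d x) (k : Fin n) : partialDeriv k f x = d k := by
  obtain ⟨f', hf, hd⟩ := h
  rw [_root_.partialDeriv, hf.fderiv, hd]

theorem add (hf : HasPartials f d x) (hg : HasPartials g e x) :
    HasPartials (fun y => f y + g y) (fun k => d k + e k) x := by
  obtain ⟨f', hf, hd⟩ := hf
  obtain ⟨g', hg, he⟩ := hg
  exact ⟨f' + g', hf.add hg, fun k => by simp [hd, he]⟩

theorem mul (hf : HasPartials f d x) (hg : HasPartials g e x) :
    HasPartials (fun y => f y * g y) (fun k => d k * g x + f x * e k) x := by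
  obtain ⟨f', hf, hd⟩ := hf
  obtain ⟨g', hg, he⟩ := hg
  exact ⟨_, hf.mul hg, fun k => by simp [hd, he]; ring⟩

theorem const (c : ℝ) : HasPartials (fun _ => c) (fun _ => 0) x :=
  ⟨0, hasFDerivAt_const _ _, fun k => by simp⟩

theorem coord (i : Fin n) : HasPartials (fun y => y i) (fun k => if i = k then 1 else 0) x := by
  refine ⟨EuclideanSpace.proj i, (EuclideanSpace.proj (𝕜 := ℝ) i).hasFDerivAt, fun k => ?_⟩
  simp

theorem norm (hx : x ≠ 0) : HasPartials (fun y => ‖y‖) (fun k => x k / ‖x‖) x := by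
  have h := ((hasStrictFDerivAt_norm_sq x).hasFDerivAt).sqrt (by positivity)
  have h2 : (fun y : EuclideanSpace ℝ (Fin n) => √(‖y‖ ^ 2)) = fun y => ‖y‖ := by
    funext y; exact Real.sqrt_sq (norm_nonneg y)
  rw [h2] at h
  refine ⟨_, h, fun k => ?_⟩
  simp [Real.sqrt_sq, EuclideanSpace.inner_single_right]
  field_simp

theorem radial {φ : ℝ → ℝ} {φ' : ℝ} (hx : x ≠ 0) (h : HasDerivAt φ φ' ‖x‖) :
    HasPartials (fun y => φ ‖y‖) (fun k => φ' / ‖x‖ * x k) x := by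
  obtain ⟨N, hN, hd⟩ := HasPartials.norm hx
  refine ⟨φ' • N, ?_, fun k => ?_⟩
  · exact h.comp_hasFDerivAt x hN
  · simp [hd]; ring

theorem congr (hf : HasPartials f d x) (h : g =ᶠ[𝓝 x] f) (hd : ∀ k, d k = e k) :
    HasPartials g e x := by
  obtain ⟨f', hf, h'⟩ := hf
  exact ⟨f', hf.congr_of_eventuallyEq h, fun k => by rw [h', hd]⟩

end HasPartials

/-- The Kronecker symbol. -/
def kron {n : ℕ} (i j : Fin n) : ℝ := if i = j then 1 else 0

section Kron

variable {n : ℕ}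

theorem kron_comm (i j : Fin n) : kron i j = kron j i := by
  simp [kron, eq_comm]

theorem sum_kron_mul (j : Fin n) (f : Fin n → ℝ) : ∑ i, kron j i * f i = f j := by
  simp [kron]

theorem sum_kron_mul' (j : Fin n) (f : Fin n → ℝ) : ∑ i, kron i j * f i = f j := by
  simp [kron]

theorem sum_sq_coord (x : EuclideanSpace ℝ (Fin n)) : ∑ i, x i * x i = ‖x‖ ^ 2 := by
  rw [EuclideanSpace.norm_sq_eq]
  exact Finset.sum_congr rfl fun i _ => by rw [Real.norm_eq_abs, sq_abs, sq]

end Kron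

/-- The coefficients of the metric `dρ² + b(ρ) ρ² g₀`, where `ρ = ‖x‖`. -/
def radialMetric {n : ℕ} (b : ℝ → ℝ) (x : EuclideanSpace ℝ (Fin n)) :
    Matrix (Fin n) (Fin n) ℝ :=
  fun i j => b ‖x‖ * kron i j + (1 - b ‖x‖) / ‖x‖ ^ 2 * (x i * x j)

/-- The metric has eigenvalue 1 in the radial direction and `b` on its orthogonal complement, so
inversion only replaces `b` by `b⁻¹`. -/
theorem radialMetric_inv {n : ℕ} (b : ℝ → ℝ) {x : EuclideanSpace ℝ (Fin n)} (hx : x ≠ 0)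
    (hb : b ‖x‖ ≠ 0) (i j : Fin n) :
    (radialMetric b x)⁻¹ i j
      = (b ‖x‖)⁻¹ * kron i j + (1 - (b ‖x‖)⁻¹) / ‖x‖ ^ 2 * (x i * x j) := by
  have hn : ‖x‖ ≠ 0 := norm_ne_zero_iff.2 hx
  have : (radialMetric b x)⁻¹ = Matrix.of fun i j : Fin n =>
      (b ‖x‖)⁻¹ * kron i j + (1 - (b ‖x‖)⁻¹) / ‖x‖ ^ 2 * (x i * x j) := by
    apply Matrix.inv_eq_right_inv
    ext i j
    simp only [Matrix.mul_apply, Matrix.of_apply]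
    have h1 : ∀ l, radialMetric b x i l *
        ((b ‖x‖)⁻¹ * kron l j + (1 - (b ‖x‖)⁻¹) / ‖x‖ ^ 2 * (x l * x j))
        = kron i l * (b ‖x‖ * ((b ‖x‖)⁻¹ * kron l j
            + (1 - (b ‖x‖)⁻¹) / ‖x‖ ^ 2 * (x l * x j)))
          + kron l j * ((1 - b ‖x‖) / ‖x‖ ^ 2 * (x i * x l) * (b ‖x‖)⁻¹)
          + (1 - b ‖x‖) / ‖x‖ ^ 2 * (1 - (b ‖x‖)⁻¹) / ‖x‖ ^ 2 * (x i * x j) * (x l * x l) := by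
      intro l; rw [radialMetric]; ring
    simp_rw [h1, Finset.sum_add_distrib]
    rw [sum_kron_mul, sum_kron_mul', ← Finset.mul_sum, sum_sq_coord, Matrix.one_apply]
    have h2 : (if i = j then (1 : ℝ) else 0) = kron i j := rfl
    rw [h2]
    field_simp
    ring
  rw [this, Matrix.of_apply]

/-- The radial coefficient of the symmetric part of the Christoffel symbols of `radialMetric`. -/
def christoffelP (b b₁ : ℝ → ℝ) (ρ : ℝ) : ℝ := b₁ ρ / ρ / (2 * b ρ)

/-- The coefficient of `xᵢ xⱼ xₖ` in the Christoffel symbols of `radialMetric`. -/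
def christoffelQ (b b₁ : ℝ → ℝ) (ρ : ℝ) : ℝ :=
  b₁ ρ / ρ / (2 * ρ ^ 2) - b₁ ρ / ρ / (b ρ * ρ ^ 2) - (1 - b ρ) / ρ ^ 4

/-- The coefficient of `xₖ δᵢⱼ` in the Christoffel symbols of `radialMetric`. -/
def christoffelS (b b₁ : ℝ → ℝ) (ρ : ℝ) : ℝ := (1 - b ρ) / ρ ^ 2 - b₁ ρ / ρ / 2

theorem hasPartials_radialMetric {n : ℕ} {b : ℝ → ℝ} {b' : ℝ} {x : EuclideanSpace ℝ (Fin n)}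
    (hx : x ≠ 0) (hb : HasDerivAt b b' ‖x‖) (i j : Fin n) :
    HasPartials (fun y => radialMetric b y i j)
      (fun k => b' / ‖x‖ * x k * kron i j
        + (-(b' / ‖x‖) / ‖x‖ ^ 2 - 2 * (1 - b ‖x‖) / ‖x‖ ^ 4) * x k * (x i * x j)
        + (1 - b ‖x‖) / ‖x‖ ^ 2 * (kron i k * x j + x i * kron j k)) x := by
  have hn : ‖x‖ ≠ 0 := norm_ne_zero_iff.2 hx
  have h1 : HasDerivAt (fun ρ => (1 - b ρ) / ρ ^ 2)
      ((-b' * ‖x‖ ^ 2 - (1 - b ‖x‖) * (2 * ‖x‖)) / (‖x‖ ^ 2) ^ 2) ‖x‖ := by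
    exact ((hb.const_sub 1).fun_div (hasDerivAt_pow 2 ‖x‖) (by positivity)).congr_deriv
      (by norm_num)
  refine (((HasPartials.radial hx hb).mul (HasPartials.const (kron i j))).add
    ((HasPartials.radial hx h1).mul
      ((HasPartials.coord i).mul (HasPartials.coord j)))).congr ?_ ?_
  · rfl
  · intro k
    simp only [kron]
    field_simp
    ring

/-- Derivatives of radial functions are multiples of `x`, so symmetry in `i`, `j` leaves just three
kinds of terms. This form is all that the Ricci computation needs. -/
theorem christoffel_radialMetric {n : ℕ} {b b₁ : ℝ → ℝ} {x : EuclideanSpace ℝ (Fin n)}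
    (hx : x ≠ 0) (hb : HasDerivAt b (b₁ ‖x‖) ‖x‖) (hb0 : b ‖x‖ ≠ 0) (k i j : Fin n) :
    christoffel (radialMetric b) k i j x
      = christoffelP b b₁ ‖x‖ * (x i * kron j k + x j * kron i k)
        + christoffelQ b b₁ ‖x‖ * (x i * (x j * x k))
        + christoffelS b b₁ ‖x‖ * (x k * kron i j) := by
  have hn : ‖x‖ ≠ 0 := norm_ne_zero_iff.2 hx
  rw [christoffel]
  have h1 : ∀ l, (radialMetric b x)⁻¹ k l *
      (partialDeriv i (fun y => radialMetric b y j l) x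
        + partialDeriv j (fun y => radialMetric b y i l) x
        - partialDeriv l (fun y => radialMetric b y i j) x)
      = kron k l * ((b ‖x‖)⁻¹ * (b₁ ‖x‖ / ‖x‖ * (x i * kron j l + x j * kron i l)
          + (2 * ((1 - b ‖x‖) / ‖x‖ ^ 2) - b₁ ‖x‖ / ‖x‖) * x l * kron i j
          + (-(b₁ ‖x‖ / ‖x‖) / ‖x‖ ^ 2 - 2 * (1 - b ‖x‖) / ‖x‖ ^ 4) * (x i * x j) * x l))
        + kron j l * ((1 - (b ‖x‖)⁻¹) / ‖x‖ ^ 2 * (x k * x l) * (b₁ ‖x‖ / ‖x‖ * x i))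
        + kron i l * ((1 - (b ‖x‖)⁻¹) / ‖x‖ ^ 2 * (x k * x l) * (b₁ ‖x‖ / ‖x‖ * x j))
        + (1 - (b ‖x‖)⁻¹) / ‖x‖ ^ 2 * x k *
          ((2 * ((1 - b ‖x‖) / ‖x‖ ^ 2) - b₁ ‖x‖ / ‖x‖) * kron i j
          + (-(b₁ ‖x‖ / ‖x‖) / ‖x‖ ^ 2 - 2 * (1 - b ‖x‖) / ‖x‖ ^ 4) * (x i * x j))
          * (x l * x l) := by
    intro l
    rw [radialMetric_inv b hx hb0, (hasPartials_radialMetric hx hb j l).partialDeriv,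
      (hasPartials_radialMetric hx hb i l).partialDeriv,
      (hasPartials_radialMetric hx hb i j).partialDeriv, kron_comm l i, kron_comm l j,
      kron_comm j i]
    ring
  simp_rw [h1, Finset.sum_add_distrib]
  rw [sum_kron_mul, sum_kron_mul, sum_kron_mul, ← Finset.mul_sum, sum_sq_coord, christoffelP,
    christoffelQ, christoffelS]
  field_simp
  ring

/-- The Ricci curvature of a metric whose Christoffel symbols have the form
`Γᵏᵢⱼ = P (xᵢ δⱼₖ + xⱼ δᵢₖ) + Q xᵢ xⱼ xₖ + S xₖ δᵢⱼ` with radial `P`, `Q`, `S`. -/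
theorem ricci_of_christoffel {n : ℕ} {g : EuclideanSpace ℝ (Fin n) → Matrix (Fin n) (Fin n) ℝ}
    {P Q S : ℝ → ℝ} {P' Q' S' : ℝ} {x : EuclideanSpace ℝ (Fin n)} (hx : x ≠ 0)
    (hg : ∀ᶠ y in 𝓝 x, ∀ k i j, christoffel g k i j y
      = P ‖y‖ * (y i * kron j k + y j * kron i k) + Q ‖y‖ * (y i * (y j * y k))
        + S ‖y‖ * (y k * kron i j))
    (hP : HasDerivAt P P' ‖x‖) (hQ : HasDerivAt Q Q' ‖x‖) (hS : HasDerivAt S S' ‖x‖)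
    (j k : Fin n) :
    ricci g j k x =
      (2 * P ‖x‖ + S' * ‖x‖ + n * S ‖x‖ - ((n + 1) * P ‖x‖ + Q ‖x‖ * ‖x‖ ^ 2 + S ‖x‖)
        + ((n + 1) * P ‖x‖ + Q ‖x‖ * ‖x‖ ^ 2 + S ‖x‖) * S ‖x‖ * ‖x‖ ^ 2
        - 2 * P ‖x‖ * S ‖x‖ * ‖x‖ ^ 2) * kron j k
      + (2 * (P' / ‖x‖) + Q' * ‖x‖ + (n + 2) * Q ‖x‖
        - ((n + 1) * (P' / ‖x‖) + Q' * ‖x‖ + 2 * Q ‖x‖ + S' / ‖x‖)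
        + ((n + 1) * P ‖x‖ + Q ‖x‖ * ‖x‖ ^ 2 + S ‖x‖) * (2 * P ‖x‖ + Q ‖x‖ * ‖x‖ ^ 2)
        - ((n + 3) * P ‖x‖ ^ 2 + 4 * P ‖x‖ * Q ‖x‖ * ‖x‖ ^ 2 + 2 * P ‖x‖ * S ‖x‖
          + Q ‖x‖ ^ 2 * ‖x‖ ^ 4 + 2 * Q ‖x‖ * S ‖x‖ * ‖x‖ ^ 2 + S ‖x‖ ^ 2)) * (x j * x k) := by
  have hn : ‖x‖ ≠ 0 := norm_ne_zero_iff.2 hx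
  have hp : ∀ k i j, HasPartials (christoffel g k i j) (fun l =>
      P' / ‖x‖ * x l * (x i * kron j k + x j * kron i k)
      + P ‖x‖ * (kron i l * kron j k + kron j l * kron i k)
      + Q' / ‖x‖ * x l * (x i * (x j * x k))
      + Q ‖x‖ * (kron i l * (x j * x k) + kron j l * (x i * x k) + kron k l * (x i * x j))
      + S' / ‖x‖ * x l * (x k * kron i j) + S ‖x‖ * (kron k l * kron i j)) x := by
    intro k i j
    refine ((((HasPartials.radial hx hP).mul
      (((HasPartials.coord i).mul (HasPartials.const (kron j k))).add
        ((HasPartials.coord j).mul (HasPartials.const (kron i k))))).add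
      ((HasPartials.radial hx hQ).mul ((HasPartials.coord i).mul
        ((HasPartials.coord j).mul (HasPartials.coord k))))).add
      ((HasPartials.radial hx hS).mul ((HasPartials.coord k).mul
        (HasPartials.const (kron i j))))).congr (hg.mono fun y hy => hy k i j) fun l => ?_
    simp only [kron]
    ring
  have hx' := hg.self_of_nhds
  rw [ricci]
  simp only [(hp _ _ _).partialDeriv, hx']
  have kk : ∀ i : Fin n, kron i i = 1 := fun i => by simp [kron]
  have hN := sum_sq_coord x
  have hQ' : Q' * ‖x‖ = Q' / ‖x‖ * ‖x‖ ^ 2 := by field_simp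
  have hS' : S' * ‖x‖ = S' / ‖x‖ * ‖x‖ ^ 2 := by field_simp
  have hN4 : ‖x‖ ^ 4 = (‖x‖ ^ 2) ^ 2 := by ring
  rw [hQ', hS', hN4]
  -- From here on the claim is a polynomial identity in the coefficients, the coordinates and
  -- Kronecker symbols; only the value `N` of `∑ xᵢ²` is still used about `x`.
  generalize P ‖x‖ = p at *
  generalize Q ‖x‖ = q at *
  generalize S ‖x‖ = s at *
  generalize P' / ‖x‖ = p' at *
  generalize Q' / ‖x‖ = q' at *
  generalize S' / ‖x‖ = s' at *
  generalize ‖x‖ ^ 2 = N at *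
  have inner : ∀ i, ∑ l, ((p * (x i * kron l i + x l * kron i i) + q * (x i * (x l * x i))
        + s * (x i * kron i l)) * (p * (x j * kron k l + x k * kron j l)
        + q * (x j * (x k * x l)) + s * (x l * kron j k))
      - (p * (x j * kron l i + x l * kron j i) + q * (x j * (x l * x i))
        + s * (x i * kron j l)) * (p * (x i * kron k l + x k * kron i l)
        + q * (x i * (x k * x l)) + s * (x l * kron i k)))
      = ((p + s) * x i * (p * (x j * kron k i + x k * kron j i) + q * (x j * x k * x i)
          + s * x i * kron j k)
        + 2 * p * (p + q * (x i * x i)) * (x j * x k)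
        + (p + q * (x i * x i)) * (q * (x j * x k) + s * kron j k) * N)
      - (p * x j * (p * (x i * kron k i + x k) + q * (x i * x i) * x k + s * x i * kron k i)
        + s * x i * (p * (x i * kron j k + x k * kron j i) + q * (x i * x k * x j)
          + s * x j * kron k i)
        + 2 * (p * kron j i + q * (x j * x i)) * x i * p * x k
        + (p * kron j i + q * (x j * x i)) * (q * (x i * x k) + s * kron k i) * N) := by
    intro i
    -- The terms are sorted by which Kronecker symbol contains `l`, the remainder being a multiple
    -- of `x l * x l`; each group then sums by a single rule. The sum over `i` below is treated in
    -- the same way.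
    have h1 : ∀ l, ((p * (x i * kron l i + x l * kron i i) + q * (x i * (x l * x i))
        + s * (x i * kron i l)) * (p * (x j * kron k l + x k * kron j l)
        + q * (x j * (x k * x l)) + s * (x l * kron j k))
      - (p * (x j * kron l i + x l * kron j i) + q * (x j * (x l * x i))
        + s * (x i * kron j l)) * (p * (x i * kron k l + x k * kron i l)
        + q * (x i * (x k * x l)) + s * (x l * kron i k)))
      = kron i l * ((p + s) * x i * (p * (x j * kron k l + x k * kron j l)
          + q * (x j * (x k * x l)) + s * (x l * kron j k))
          - p * x j * (p * (x i * kron k l + x k * kron i l)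
          + q * (x i * (x k * x l)) + s * (x l * kron i k))
          - (p * kron j i + q * (x j * x i)) * x l * p * x k)
        + kron k l * (x l * (p + q * (x i * x i)) * p * x j
          - (p * kron j i + q * (x j * x i)) * x l * p * x i)
        + kron j l * (x l * (p + q * (x i * x i)) * p * x k
          - s * x i * (p * (x i * kron k l + x k * kron i l)
          + q * (x i * (x k * x l)) + s * (x l * kron i k)))
        + ((p + q * (x i * x i)) * (q * (x j * x k) + s * kron j k)
          - (p * kron j i + q * (x j * x i)) * (q * (x i * x k) + s * kron i k))
          * (x l * x l) := by
      intro l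
      rw [kron_comm l i, kk i]
      ring
    simp_rw [h1, Finset.sum_add_distrib]
    rw [sum_kron_mul, sum_kron_mul, sum_kron_mul, ← Finset.mul_sum, hN, kk i,
      kron_comm i k, kron_comm i j, kron_comm k j]
    ring
  simp_rw [inner]
  have h2 : ∀ i, (p' * x i * (x j * kron k i + x k * kron j i)
        + p * (kron j i * kron k i + kron k i * kron j i)
        + q' * x i * (x j * (x k * x i))
        + q * (kron j i * (x k * x i) + kron k i * (x j * x i) + kron i i * (x j * x k))
        + s' * x i * (x i * kron j k) + s * (kron i i * kron j k)
      - (p' * x j * (x i * kron k i + x k * kron i i)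
        + p * (kron i j * kron k i + kron k j * kron i i)
        + q' * x j * (x i * (x k * x i))
        + q * (kron i j * (x k * x i) + kron k j * (x i * x i) + kron i j * (x i * x k))
        + s' * x j * (x i * kron i k) + s * (kron i j * kron i k))
      + (((p + s) * x i * (p * (x j * kron k i + x k * kron j i) + q * (x j * x k * x i)
          + s * x i * kron j k)
        + 2 * p * (p + q * (x i * x i)) * (x j * x k)
        + (p + q * (x i * x i)) * (q * (x j * x k) + s * kron j k) * N)
      - (p * x j * (p * (x i * kron k i + x k) + q * (x i * x i) * x k + s * x i * kron k i)
        + s * x i * (p * (x i * kron j k + x k * kron j i) + q * (x i * x k * x j)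
          + s * x j * kron k i)
        + 2 * (p * kron j i + q * (x j * x i)) * x i * p * x k
        + (p * kron j i + q * (x j * x i)) * (q * (x i * x k) + s * kron k i) * N)))
      = kron j i * (p' * x i * x k + (p - s) * kron k i - q * (x k * x i)
          + (p + s) * x i * p * x k - s * p * (x i * x k) - 2 * p ^ 2 * (x i * x k)
          - p * N * (q * (x i * x k) + s * kron k i))
        + kron k i * (q * (x j * x i) - s' * (x j * x i) - s ^ 2 * (x i * x j)
          - q * (x j * x i) * s * N)
        + (s' * kron j k - q * kron j k + (p + s) * (q * (x j * x k) + s * kron j k)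
          + q * (q * (x j * x k) + s * kron j k) * N - p * q * (x j * x k)
          - s * (p * kron j k + q * (x k * x j)) - q ^ 2 * (x j * x k) * N) * (x i * x i)
        + (q * (x j * x k) + s * kron j k - p' * (x j * x k) - p * kron j k
          + p ^ 2 * (x j * x k) + p * (q * (x j * x k) + s * kron j k) * N) := by
    intro i
    rw [kk i, kron_comm i j, kron_comm i k, kron_comm k j]
    ring
  simp_rw [h2, Finset.sum_add_distrib]
  rw [sum_kron_mul, sum_kron_mul, ← Finset.mul_sum, hN, kron_comm k j]
  simp only [Finset.sum_const, Finset.card_univ, Fintype.card_fin, nsmul_eq_mul]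
  ring

/-- The trace in an adapted frame: `n - 1` tangential directions contribute `b⁻¹ U` each, the radial
one `U + V ‖x‖²`. -/
theorem scalarCurvature_radialMetric_of_ricci {n : ℕ} {b : ℝ → ℝ}
    {x : EuclideanSpace ℝ (Fin n)} (hx : x ≠ 0) (hb : b ‖x‖ ≠ 0) {U V : ℝ}
    (h : ∀ j k, ricci (radialMetric b) j k x = U * kron j k + V * (x j * x k)) :
    scalarCurvature (radialMetric b) x
      = (n - 1) * (b ‖x‖)⁻¹ * U + U + V * ‖x‖ ^ 2 := by
  have hn : ‖x‖ ≠ 0 := norm_ne_zero_iff.2 hx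
  have h1 : ∀ j k, (radialMetric b x)⁻¹ j k * ricci (radialMetric b) j k x
      = kron j k * ((b ‖x‖)⁻¹ * (U * kron j k + V * (x j * x k))
        + (1 - (b ‖x‖)⁻¹) / ‖x‖ ^ 2 * U * (x j * x k))
        + (1 - (b ‖x‖)⁻¹) / ‖x‖ ^ 2 * V * (x j * x j) * (x k * x k) := by
    intro j k
    rw [h, radialMetric_inv b hx hb]
    ring
  have kk : ∀ i : Fin n, kron i i = 1 := fun i => by simp [kron]
  rw [scalarCurvature]
  simp_rw [h1, Finset.sum_add_distrib, sum_kron_mul, ← Finset.mul_sum, sum_sq_coord,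
    ← Finset.sum_mul, ← Finset.mul_sum, kk, Finset.sum_add_distrib, ← Finset.mul_sum,
    Finset.sum_add_distrib, ← Finset.mul_sum, sum_sq_coord]
  simp only [Finset.sum_const, Finset.card_univ, Fintype.card_fin, nsmul_eq_mul]
  field_simp
  ring

theorem rotMetricCoeff_eq_radialMetric {n : ℕ} (r : ℝ → ℝ) :
    rotMetricCoeff (n := n) r = radialMetric fun ρ => (r (ρ - 1) / ρ) ^ 2 := by
  funext x i j
  simp only [rotMetricCoeff, radialMetric, kron]
  ring

/-- The scalar curvature of `ds² + r(s)² g₀`. -/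
theorem scalarCurvature_rotMetricCoeff {n : ℕ} {r r₁ : ℝ → ℝ} {r₂ : ℝ}
    {x : EuclideanSpace ℝ (Fin n)} (hx : 1 < ‖x‖) (hpos : ∀ s, 0 < s → 0 < r s)
    (hr : ∀ s, 0 < s → HasDerivAt r (r₁ s) s) (hr₁ : HasDerivAt r₁ r₂ (‖x‖ - 1)) :
    scalarCurvature (rotMetricCoeff r) x
      = (n - 1) * ((n - 2) * (1 - r₁ (‖x‖ - 1) ^ 2) / r (‖x‖ - 1) ^ 2
          - 2 * r₂ / r (‖x‖ - 1)) := by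
  rw [rotMetricCoeff_eq_radialMetric]
  set b : ℝ → ℝ := fun ρ => (r (ρ - 1) / ρ) ^ 2 with hb
  set b₁ : ℝ → ℝ := fun ρ => 2 * (r (ρ - 1) / ρ) * ((r₁ (ρ - 1) * ρ - r (ρ - 1)) / ρ ^ 2) with hb₁
  have hx0 : x ≠ 0 := norm_ne_zero_iff.1 (by linarith)
  have hbd : ∀ ρ, 1 < ρ → HasDerivAt b (b₁ ρ) ρ := by
    intro ρ hρ
    have h1 := ((hr (ρ - 1) (by linarith)).comp_sub_const ρ 1)
    exact ((h1.fun_div (hasDerivAt_id ρ) (by simp; linarith)).fun_pow 2).congr_deriv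
      (by simp [hb₁])
  have hbpos : ∀ ρ, 1 < ρ → 0 < b ρ := fun ρ hρ => by
    have := hpos (ρ - 1) (by linarith)
    simp only [hb]; positivity
  have hev : ∀ᶠ y : EuclideanSpace ℝ (Fin n) in 𝓝 x, 1 < ‖y‖ :=
    continuous_norm.continuousAt.eventually (lt_mem_nhds hx)
  have hch : ∀ᶠ y in 𝓝 x, ∀ k i j, christoffel (radialMetric b) k i j y
      = christoffelP b b₁ ‖y‖ * (y i * kron j k + y j * kron i k)
        + christoffelQ b b₁ ‖y‖ * (y i * (y j * y k))
        + christoffelS b b₁ ‖y‖ * (y k * kron i j) := by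
    filter_upwards [hev] with y hy k i j
    exact christoffel_radialMetric (norm_ne_zero_iff.1 (by linarith)) (hbd _ hy)
      (hbpos _ hy).ne' k i j
  have hR := hr (‖x‖ - 1) (by linarith)
  have hR0 := (hpos (‖x‖ - 1) (by linarith)).ne'
  have hb₁d : ∃ b₂, b₂ = 2 * ((r₁ (‖x‖ - 1) * ‖x‖ - r (‖x‖ - 1)) / ‖x‖ ^ 2) ^ 2
      + 2 * (r (‖x‖ - 1) / ‖x‖) * (r₂ / ‖x‖ - 2 * r₁ (‖x‖ - 1) / ‖x‖ ^ 2
        + 2 * r (‖x‖ - 1) / ‖x‖ ^ 3) ∧ HasDerivAt b₁ b₂ ‖x‖ := by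
    refine ⟨_, rfl, ?_⟩
    have h1 := hR.comp_sub_const ‖x‖ 1
    have h2 := hr₁.comp_sub_const ‖x‖ 1
    have hn : ‖x‖ ≠ 0 := by linarith
    refine (((h1.fun_div (hasDerivAt_id ‖x‖) hn).const_mul 2).fun_mul
      (((h2.fun_mul (hasDerivAt_id ‖x‖)).fun_sub h1).fun_div (hasDerivAt_pow 2 ‖x‖)
        (by positivity))).congr_deriv ?_
    simp
    field_simp
    ring
  obtain ⟨b₂, hb₂, hb₁d⟩ := hb₁d
  have hn : ‖x‖ ≠ 0 := by linarith
  have hb0 := (hbpos _ hx).ne'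
  have hid := hasDerivAt_id ‖x‖
  have hB := (hbd _ hx)
  have hq := hb₁d.fun_div hid hn
  have hP := hq.fun_div (hB.const_mul 2) (by simpa using hb0)
  have hS := ((hB.const_sub 1).fun_div (hasDerivAt_pow 2 ‖x‖) (by positivity)).fun_sub
    (hq.div_const 2)
  have hQ := ((hq.fun_div ((hasDerivAt_pow 2 ‖x‖).const_mul 2) (by positivity)).fun_sub
    (hq.fun_div (hB.fun_mul (hasDerivAt_pow 2 ‖x‖)) (by positivity))).fun_sub
    ((hB.const_sub 1).fun_div (hasDerivAt_pow 4 ‖x‖) (by positivity))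
  rw [scalarCurvature_radialMetric_of_ricci hx0 hb0
    (ricci_of_christoffel (P := christoffelP b b₁) (Q := christoffelQ b b₁)
      (S := christoffelS b b₁) hx0 hch hP hQ hS)]
  simp only [christoffelP, christoffelQ, christoffelS, id, hb₂]
  have e1 : b ‖x‖ = (r (‖x‖ - 1) / ‖x‖) ^ 2 := rfl
  have e2 : b₁ ‖x‖ = 2 * (r (‖x‖ - 1) / ‖x‖)
    * ((r₁ (‖x‖ - 1) * ‖x‖ - r (‖x‖ - 1)) / ‖x‖ ^ 2) := rfl
  rw [e1, e2]
  clear_value b b₁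
  generalize r (‖x‖ - 1) = R at *
  generalize r₁ (‖x‖ - 1) = R₁ at *
  generalize ‖x‖ = N at *
  clear * - hR0 hn
  norm_num
  field_simp
  ring

/-! ### Length distances on warped cylinders -/

namespace WarpedCylinder

variable {n : ℕ} (N : WarpedCylinder)

/-- The points `(s, θ)` with `s ∈ I`. -/
def strip (n : ℕ) (I : Set ℝ) : Set (ℝ × EuclideanSpace ℝ (Fin n)) :=
  {p | p.1 ∈ I ∧ ‖p.2‖ = 1}

/-- The speed of a curve in the metric `ds² + radius(s)² g₀`. -/
def speed (γ : ℝ → ℝ × EuclideanSpace ℝ (Fin n)) (u : ℝ) : ℝ :=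
  √((deriv (fun v => (γ v).1) u) ^ 2
      + (N.radius (γ u).1) ^ 2 * ‖deriv (fun v => (γ v).2) u‖ ^ 2)

theorem length_eq_Ioo (γ : ℝ → ℝ × EuclideanSpace ℝ (Fin n)) :
    N.length γ = ∫⁻ u in Ioo (0 : ℝ) 1, ENNReal.ofReal (N.speed γ u) :=
  setLIntegral_congr Ioo_ae_eq_Icc.symm

theorem distIn_le {U : Set (ℝ × EuclideanSpace ℝ (Fin n))}
    {γ : ℝ → ℝ × EuclideanSpace ℝ (Fin n)} (h : ContDiffOn ℝ 1 γ (Icc 0 1))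
    (hU : MapsTo γ (Icc 0 1) U) : N.distIn U (γ 0) (γ 1) ≤ N.length γ :=
  iInf₂_le γ ⟨h, hU, rfl, rfl⟩

theorem exists_length_lt {U : Set (ℝ × EuclideanSpace ℝ (Fin n))}
    {p q : ℝ × EuclideanSpace ℝ (Fin n)} {c : ℝ≥0∞} (h : N.distIn U p q < c) :
    ∃ γ : ℝ → ℝ × EuclideanSpace ℝ (Fin n), ContDiffOn ℝ 1 γ (Icc 0 1) ∧
      MapsTo γ (Icc 0 1) U ∧ γ 0 = p ∧ γ 1 = q ∧ N.length γ < c := by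
  rw [distIn, iInf_lt_iff] at h
  obtain ⟨γ, h⟩ := h
  rw [iInf_lt_iff] at h
  obtain ⟨⟨h1, h2, h3, h4⟩, h⟩ := h
  exact ⟨γ, h1, h2, h3, h4, h⟩

theorem hasDerivAt_of_contDiffOn {E : Type*} [NormedAddCommGroup E] [NormedSpace ℝ E]
    {f : ℝ → E} (h : ContDiffOn ℝ 1 f (Icc 0 1)) {u : ℝ} (hu : u ∈ Ioo (0 : ℝ) 1) :
    HasDerivAt f (deriv f u) u :=
  ((h.differentiableOn one_ne_zero).differentiableAt (Icc_mem_nhds hu.1 hu.2)).hasDerivAt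

/-- Traversing a curve with a different monotone parametrization. -/
theorem lintegral_speed_comp {γ : ℝ → ℝ × EuclideanSpace ℝ (Fin n)}
    (h : ContDiffOn ℝ 1 γ (Icc 0 1)) {σ σ' : ℝ → ℝ} {a b : ℝ}
    (hσ : ∀ u ∈ Ioo a b, HasDerivAt σ (σ' u) u) (hmono : Monotone σ)
    (hmaps : MapsTo σ (Ioo a b) (Ioo 0 1)) :
    ∫⁻ u in Ioo a b, ENNReal.ofReal (N.speed (γ ∘ σ) u) ≤ N.length γ := by
  have h1 : ∫⁻ u in Ioo a b, ENNReal.ofReal (N.speed (γ ∘ σ) u)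
      = ∫⁻ u in Ioo a b, ENNReal.ofReal (σ' u) * ENNReal.ofReal (N.speed γ (σ u)) := by
    refine setLIntegral_congr_fun measurableSet_Ioo fun u hu => ?_
    have hd := hσ u hu
    have hnn : 0 ≤ σ' u := by
      rw [← hd.deriv]; exact hmono.deriv_nonneg
    have e1 : deriv (fun v => ((γ ∘ σ) v).1) u = σ' u * deriv (fun v => (γ v).1) (σ u) :=
      ((hasDerivAt_of_contDiffOn (contDiff_fst.comp_contDiffOn h) (hmaps hu)).scomp u hd).deriv
    have e2 : deriv (fun v => ((γ ∘ σ) v).2) u = σ' u • deriv (fun v => (γ v).2) (σ u) :=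
      ((hasDerivAt_of_contDiffOn (contDiff_snd.comp_contDiffOn h) (hmaps hu)).scomp u hd).deriv
    rw [← ENNReal.ofReal_mul hnn]
    congr 1
    rw [speed, speed, e1, e2, norm_smul, Real.norm_eq_abs, mul_pow, mul_pow, sq_abs,
      ← Real.sqrt_sq hnn, ← Real.sqrt_mul (sq_nonneg _), Real.sqrt_sq hnn]
    congr 1
    simp only [Function.comp]
    ring
  -- The change of variables needs monotonicity only, so `σ` may be constant on intervals.
  rw [h1, ← lintegral_image_eq_lintegral_deriv_mul_of_monotoneOn measurableSet_Ioo
    (fun u hu => (hσ u hu).hasDerivWithinAt) (hmono.monotoneOn _)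
    (fun u => ENNReal.ofReal (N.speed γ u)), length_eq_Ioo]
  exact lintegral_mono_set hmaps.image_subset

/-- Concatenated `C¹` curves may have a corner. Each half is therefore traversed with a smooth
parameter that becomes stationary at the junction `w`, so that `γ₁ ∘ σ₁ + γ₂ ∘ σ₂ - w` is `C¹` and
equals one of the two curves on each half of the interval. -/
theorem distIn_triangle (U : Set (ℝ × EuclideanSpace ℝ (Fin n)))
    (p w q : ℝ × EuclideanSpace ℝ (Fin n)) :
    N.distIn U p q ≤ N.distIn U p w + N.distIn U w q := by
  refine ENNReal.le_of_forall_pos_le_add fun ε hε hfin => ?_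
  obtain ⟨hf1, hf2⟩ := ENNReal.add_lt_top.1 hfin
  have hε2 : (ε / 2 : ℝ≥0∞) ≠ 0 := by simpa using hε.ne'
  obtain ⟨γ₁, c₁, m₁, a₁, b₁, l₁⟩ := N.exists_length_lt (ENNReal.lt_add_right hf1.ne hε2)
  obtain ⟨γ₂, c₂, m₂, a₂, b₂, l₂⟩ := N.exists_length_lt (ENNReal.lt_add_right hf2.ne hε2)
  set σ₁ : ℝ → ℝ := fun u => Real.smoothTransition (2 * u)
  set σ₂ : ℝ → ℝ := fun u => Real.smoothTransition (2 * u - 1)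
  have s₁ : ContDiff ℝ 1 σ₁ := Real.smoothTransition.contDiff.comp (by fun_prop)
  have s₂ : ContDiff ℝ 1 σ₂ := Real.smoothTransition.contDiff.comp (by fun_prop)
  have r₁ : ∀ u, σ₁ u ∈ Icc (0 : ℝ) 1 := fun u =>
    ⟨Real.smoothTransition.nonneg _, Real.smoothTransition.le_one _⟩
  have r₂ : ∀ u, σ₂ u ∈ Icc (0 : ℝ) 1 := fun u =>
    ⟨Real.smoothTransition.nonneg _, Real.smoothTransition.le_one _⟩
  have mo₁ : Monotone σ₁ := fun u v h => Real.smoothTransition.monotone (by linarith)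
  have mo₂ : Monotone σ₂ := fun u v h => Real.smoothTransition.monotone (by linarith)
  set γ : ℝ → ℝ × EuclideanSpace ℝ (Fin n) := fun u => γ₁ (σ₁ u) + γ₂ (σ₂ u) - w with hγ
  have left : ∀ u, u ≤ 1 / 2 → γ u = (γ₁ ∘ σ₁) u := fun u hu => by
    have : σ₂ u = 0 := Real.smoothTransition.zero_of_nonpos (by linarith)
    simp [hγ, this, a₂]
  have right : ∀ u, 1 / 2 ≤ u → γ u = (γ₂ ∘ σ₂) u := fun u hu => by
    have : σ₁ u = 1 := Real.smoothTransition.one_of_one_le (by linarith)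
    simp [hγ, this, b₁]
  have hc : ContDiff ℝ 1 γ := by
    have g₁ : ContDiff ℝ 1 (fun u => γ₁ (σ₁ u)) :=
      contDiffOn_univ.1 (c₁.comp s₁.contDiffOn fun u _ => r₁ u)
    have g₂ : ContDiff ℝ 1 (fun u => γ₂ (σ₂ u)) :=
      contDiffOn_univ.1 (c₂.comp s₂.contDiffOn fun u _ => r₂ u)
    exact (g₁.add g₂).sub contDiff_const
  have hm : MapsTo γ (Icc 0 1) U := by
    intro u hu
    rcases le_total u (1 / 2) with h | h
    · rw [left u h]; exact m₁ (r₁ u)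
    · rw [right u h]; exact m₂ (r₂ u)
  have e0 : γ 0 = p := by
    rw [left 0 (by norm_num)]; simp [σ₁, a₁]
  have e1 : γ 1 = q := by
    rw [right 1 (by norm_num)]
    have : σ₂ 1 = 1 := Real.smoothTransition.one_of_one_le (by norm_num)
    simp [this, b₂]
  have hle := N.distIn_le hc.contDiffOn hm
  rw [e0, e1] at hle
  refine hle.trans ?_
  have hsplit : N.length γ = (∫⁻ u in Ioo (0 : ℝ) (1 / 2), ENNReal.ofReal (N.speed γ u))
      + ∫⁻ u in Ioo (1 / 2 : ℝ) 1, ENNReal.ofReal (N.speed γ u) := by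
    rw [length_eq_Ioo, ← Ioc_union_Ioo_eq_Ioo (show (0 : ℝ) < 1 / 2 by norm_num).le
      (show (1 / 2 : ℝ) < 1 by norm_num), lintegral_union measurableSet_Ioo,
      setLIntegral_congr Ioo_ae_eq_Ioc.symm]
    exact Set.disjoint_left.2 fun u h1 h2 => absurd h1.2 (not_le.2 h2.1)
  have speed_congr : ∀ {α : ℝ → ℝ × EuclideanSpace ℝ (Fin n)} {a b : ℝ},
      (∀ u ∈ Ioo a b, γ u = α u) → ∫⁻ u in Ioo a b, ENNReal.ofReal (N.speed γ u)
        = ∫⁻ u in Ioo a b, ENNReal.ofReal (N.speed α u) := by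
    intro α a b h
    refine setLIntegral_congr_fun measurableSet_Ioo fun u hu => ?_
    have hev : γ =ᶠ[𝓝 u] α :=
      EqOn.eventuallyEq_of_mem (fun v hv => h v hv) (Ioo_mem_nhds hu.1 hu.2)
    have h1 : deriv (fun v => (γ v).1) u = deriv (fun v => (α v).1) u :=
      Filter.EventuallyEq.deriv_eq (hev.fun_comp Prod.fst)
    have h2 : deriv (fun v => (γ v).2) u = deriv (fun v => (α v).2) u :=
      Filter.EventuallyEq.deriv_eq (hev.fun_comp Prod.snd)
    simp only [speed, h1, h2, h u hu]
  have d₁ : ∫⁻ u in Ioo (0 : ℝ) (1 / 2), ENNReal.ofReal (N.speed γ u) ≤ N.length γ₁ := by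
    rw [speed_congr fun u hu => left u hu.2.le]
    exact N.lintegral_speed_comp c₁
      (fun u _ => (s₁.differentiable one_ne_zero u).hasDerivAt) mo₁
      fun u hu => ⟨Real.smoothTransition.pos_of_pos (by linarith [hu.1]),
        Real.smoothTransition.lt_one_of_lt_one (by linarith [hu.2])⟩
  have d₂ : ∫⁻ u in Ioo (1 / 2 : ℝ) 1, ENNReal.ofReal (N.speed γ u) ≤ N.length γ₂ := by
    rw [speed_congr fun u hu => right u hu.1.le]
    exact N.lintegral_speed_comp c₂
      (fun u _ => (s₂.differentiable one_ne_zero u).hasDerivAt) mo₂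
      fun u hu => ⟨Real.smoothTransition.pos_of_pos (by linarith [hu.1]),
        Real.smoothTransition.lt_one_of_lt_one (by linarith [hu.2])⟩
  calc N.length γ ≤ N.length γ₁ + N.length γ₂ := hsplit ▸ add_le_add d₁ d₂
    _ ≤ (N.distIn U p w + ε / 2) + (N.distIn U w q + ε / 2) := add_le_add l₁.le l₂.le
    _ = N.distIn U p w + N.distIn U w q + (ε / 2 + ε / 2) := by ring
    _ = N.distIn U p w + N.distIn U w q + ε := by rw [ENNReal.add_halves]

/-- The distance along a radial segment. -/
theorem distIn_strip_radial_le {I : Set ℝ} (hI : I.OrdConnected) {a b : ℝ} (ha : a ∈ I)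
    (hb : b ∈ I) {θ : EuclideanSpace ℝ (Fin n)} (hθ : ‖θ‖ = 1) :
    N.distIn (strip n I) (a, θ) (b, θ) ≤ ENNReal.ofReal |b - a| := by
  set γ : ℝ → ℝ × EuclideanSpace ℝ (Fin n) := fun u => (a + u * (b - a), θ) with hγ
  have hc : ContDiff ℝ 1 γ := by fun_prop
  have hm : MapsTo γ (Icc 0 1) (strip n I) := fun u hu => by
    refine ⟨?_, hθ⟩
    have := hI.convex.add_smul_sub_mem ha hb hu
    simpa [hγ] using this
  have h := N.distIn_le hc.contDiffOn hm
  have e0 : γ 0 = (a, θ) := by simp [hγ]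
  have e1 : γ 1 = (b, θ) := by simp [hγ]
  rw [e0, e1] at h
  refine h.trans (le_of_eq ?_)
  have hs : ∀ u, N.speed γ u = |b - a| := fun u => by
    have h1 : deriv (fun v => (γ v).1) u = b - a :=
      (((hasDerivAt_id u).mul_const (b - a)).const_add a).deriv.trans (one_mul _)
    have h2 : deriv (fun v => (γ v).2) u = 0 := by simp [hγ]
    rw [speed, h1, h2]
    simp [Real.sqrt_sq_eq_abs]
  rw [length_eq_Ioo]
  simp [hs]

/-- Distances dominate differences of the radial coordinate. -/
theorem ofReal_abs_sub_le_distIn (U : Set (ℝ × EuclideanSpace ℝ (Fin n)))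
    (p q : ℝ × EuclideanSpace ℝ (Fin n)) : ENNReal.ofReal |q.1 - p.1| ≤ N.distIn U p q := by
  refine le_iInf₂ fun γ ⟨hc, _, h0, h1⟩ => ?_
  have h := enorm_sub_le_lintegral_deriv_of_contDiffOn_Icc
    (contDiff_fst.comp_contDiffOn hc) zero_le_one
  simp only [Function.comp, h0, h1] at h
  rw [← Real.norm_eq_abs, ofReal_norm]
  refine h.trans (lintegral_mono fun u => ?_)
  rw [← ofReal_norm, Real.norm_eq_abs]
  refine ENNReal.ofReal_le_ofReal (Real.abs_le_sqrt ?_)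
  have : 0 ≤ (N.radius (γ u).1) ^ 2 * ‖deriv (fun v => (γ v).2) u‖ ^ 2 := by positivity
  exact le_add_of_nonneg_right this

end WarpedCylinder

/-- A monotone Lipschitz function is a limit from above of monotone `C¹` functions with the same
Lipschitz constant. -/
theorem exists_contDiff_approx {F : ℝ → ℝ} {K : ℝ} (hmono : Monotone F)
    (hlip : ∀ u v, u ≤ v → F v - F u ≤ K * (v - u)) {τ : ℝ} (hτ : 0 < τ) :
    ∃ G : ℝ → ℝ, ContDiff ℝ 1 G ∧ (∀ s, 0 ≤ deriv G s ∧ deriv G s ≤ K) ∧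
      ∀ s, F s ≤ G s ∧ G s ≤ F (s + τ) := by
  have hcont : Continuous F := by
    have : LipschitzWith K.toNNReal F := LipschitzWith.of_le_add_mul _ fun u v => by
      rcases le_total u v with h | h
      · have := hmono h
        have : 0 ≤ (K.toNNReal : ℝ) * dist u v := by positivity
        linarith
      · have h1 := hlip v u h
        rw [Real.dist_eq, abs_of_nonneg (by linarith)]
        have h2 : K * (u - v) ≤ K.toNNReal * (u - v) :=
          mul_le_mul_of_nonneg_right (Real.le_coe_toNNReal K) (by linarith)
        linarith
    exact this.continuous
  -- The approximation is the average of `F` over `[s, s + τ]`. Averaging forward puts it between `F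
  -- s` and `F (s + τ)`.
  set Φ : ℝ → ℝ := fun s => ∫ v in (0 : ℝ)..s, F v with hΦ
  have hd : ∀ s, HasDerivAt Φ (F s) s := fun s => hcont.integral_hasStrictDerivAt 0 s |>.hasDerivAt
  have hdG : ∀ s, HasDerivAt (fun s => (Φ (s + τ) - Φ s) / τ) ((F (s + τ) - F s) / τ) s :=
    fun s => (((hd (s + τ)).comp_add_const s τ).fun_sub (hd s)).div_const τ
  refine ⟨fun s => (Φ (s + τ) - Φ s) / τ, ?_, fun s => ?_, fun s => ?_⟩
  · rw [contDiff_one_iff_deriv]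
    refine ⟨fun s => (hdG s).differentiableAt, ?_⟩
    rw [show deriv (fun s => (Φ (s + τ) - Φ s) / τ) = fun s => (F (s + τ) - F s) / τ from
      funext fun s => (hdG s).deriv]
    fun_prop
  · rw [(hdG s).deriv]
    refine ⟨div_nonneg (sub_nonneg.2 (hmono (by linarith))) hτ.le, ?_⟩
    rw [div_le_iff₀ hτ]
    have := hlip s (s + τ) (by linarith)
    linarith
  · obtain ⟨c, hc, he⟩ := exists_hasDerivAt_eq_slope Φ F (show s < s + τ by linarith)
      (fun x _ => (hd x).continuousAt.continuousWithinAt) (fun x _ => hd x)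
    rw [add_sub_cancel_left] at he
    simp only [← he]
    exact ⟨hmono hc.1.le, hmono hc.2.le⟩

/-! ### Effect of radial maps on length distances -/

namespace WarpedCylinder

variable {n : ℕ}

/-- The image of a curve under `(s, θ) ↦ (G s, θ)` has both the radial and the spherical part of its
speed multiplied by at most `K`. -/
theorem distIn_strip_map_le_of_contDiff {N N' : WarpedCylinder} {I I' : Set ℝ} {G : ℝ → ℝ}
    {K : ℝ} (hK : 0 < K) (hG : ContDiff ℝ 1 G) (hd : ∀ s, 0 ≤ deriv G s ∧ deriv G s ≤ K)
    (hI : ∀ t, G t ∈ I') (hr : ∀ t ∈ I, 0 ≤ N'.radius (G t))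
    (hrad : ∀ t ∈ I, N'.radius (G t) ≤ K * N.radius t)
    (p q : ℝ × EuclideanSpace ℝ (Fin n)) :
    N'.distIn (strip n I') (G p.1, p.2) (G q.1, q.2)
      ≤ ENNReal.ofReal K * N.distIn (strip n I) p q := by
  have hK0 : ENNReal.ofReal K ≠ 0 := by simpa using hK
  rw [mul_comm, ← ENNReal.div_le_iff_le_mul (Or.inl hK0) (Or.inl ENNReal.ofReal_ne_top)]
  refine le_iInf₂ fun γ ⟨hc, hm, h0, h1⟩ => ?_
  rw [ENNReal.div_le_iff_le_mul (Or.inl hK0) (Or.inl ENNReal.ofReal_ne_top), mul_comm]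
  set γ' : ℝ → ℝ × EuclideanSpace ℝ (Fin n) := fun u => (G (γ u).1, (γ u).2) with hγ'
  have hc' : ContDiffOn ℝ 1 γ' (Icc 0 1) :=
    (hG.comp_contDiffOn (contDiff_fst.comp_contDiffOn hc)).prodMk
      (contDiff_snd.comp_contDiffOn hc)
  have hm' : MapsTo γ' (Icc 0 1) (strip n I') := fun u hu => ⟨hI _, (hm hu).2⟩
  have h := N'.distIn_le hc' hm'
  simp only [hγ', h0, h1] at h
  refine h.trans ?_
  rw [length_eq_Ioo, length_eq_Ioo, ← lintegral_const_mul' _ _ ENNReal.ofReal_ne_top]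
  refine setLIntegral_mono' measurableSet_Ioo fun u hu => ?_
  rw [← ENNReal.ofReal_mul hK.le]
  refine ENNReal.ofReal_le_ofReal ?_
  have hs := hm (Ioo_subset_Icc_self hu)
  have hdu := hasDerivAt_of_contDiffOn (contDiff_fst.comp_contDiffOn hc) hu
  have e1 : deriv (fun v => (γ' v).1) u = deriv G (γ u).1 * deriv (fun v => (γ v).1) u :=
    (((hG.differentiable one_ne_zero (γ u).1).hasDerivAt).comp u hdu).deriv
  rw [speed, speed, e1]
  refine (Real.sqrt_le_left (by positivity)).2 ?_
  rw [mul_pow, mul_pow, Real.sq_sqrt (by positivity)]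
  have i1 : deriv G (γ u).1 ^ 2 ≤ K ^ 2 := pow_le_pow_left₀ (hd _).1 (hd _).2 2
  have i2 : N'.radius (G (γ u).1) ^ 2 ≤ (K * N.radius (γ u).1) ^ 2 :=
    pow_le_pow_left₀ (hr _ hs.1) (hrad _ hs.1) 2
  have i3 := mul_le_mul_of_nonneg_right i1 (sq_nonneg (deriv (fun v => (γ v).1) u))
  have i4 := mul_le_mul_of_nonneg_right i2 (sq_nonneg ‖deriv (fun v => (γ v).2) u‖)
  simp only [hγ'] at *
  nlinarith

/-- A monotone `K`-Lipschitz change of the radial coordinate that increases the radii at most by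
the factor `K` increases distances at most by the factor `K`. -/
theorem distIn_strip_map_le {N N' : WarpedCylinder} {I I' : Set ℝ} {F : ℝ → ℝ} {K c : ℝ}
    (hK : 0 < K) (hI' : I'.OrdConnected) (hmono : Monotone F)
    (hlip : ∀ u v, u ≤ v → F v - F u ≤ K * (v - u)) (hI : ∀ t, F t ∈ I')
    (hrad : ∀ t ∈ I, N'.radius (F t) ≤ K * N.radius t)
    (hr : ∀ t ∈ I', 0 ≤ N'.radius t)
    (hr' : ∀ u ∈ I', ∀ v ∈ I', u ≤ v → N'.radius v ≤ N'.radius u + (v - u))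
    (hc : 0 < c) (hcr : ∀ t ∈ I, c ≤ N.radius t)
    {p q : ℝ × EuclideanSpace ℝ (Fin n)} (hp : ‖p.2‖ = 1) (hq : ‖q.2‖ = 1) :
    N'.distIn (strip n I') (F p.1, p.2) (F q.1, q.2)
      ≤ ENNReal.ofReal K * N.distIn (strip n I) p q := by
  have hK0 : ENNReal.ofReal K ≠ 0 := by simpa using hK
  rcases eq_or_ne (N.distIn (strip n I) p q) ⊤ with htop | htop
  · rw [htop, ENNReal.mul_top hK0]; exact le_top
  -- With the smoothing `G` in place of `F`, each endpoint moves by at most `K τ`. The target radius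
  -- also grows by at most `K τ`, which the lower bound `c` on the source radius turns into a
  -- factor. All errors vanish as `τ → 0`.
  have key : ∀ τ : ℝ, 0 < τ → N'.distIn (strip n I') (F p.1, p.2) (F q.1, q.2)
      ≤ ENNReal.ofReal (K * τ) + (ENNReal.ofReal (K + K * τ / c) * N.distIn (strip n I) p q
        + ENNReal.ofReal (K * τ)) := by
    intro τ hτ
    obtain ⟨G, hG, hd, hFG⟩ := exists_contDiff_approx hmono hlip hτ
    have hGI : ∀ t, G t ∈ I' := fun t => hI'.out (hI t) (hI (t + τ)) (hFG t)
    have hGF : ∀ t, G t - F t ≤ K * τ := fun t => by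
      have := hlip t (t + τ) (by linarith)
      have := (hFG t).2
      rw [add_sub_cancel_left] at *
      linarith
    have hpos : 0 < K * τ / c := by positivity
    have h2 := distIn_strip_map_le_of_contDiff (n := n) (N := N) (N' := N') (I := I) (I' := I')
      (K := K + K * τ / c) (by positivity) hG
      (fun s => ⟨(hd s).1, (hd s).2.trans (by linarith)⟩) hGI (fun t _ => hr _ (hGI t))
      (fun t ht => by
        have h1 := hr' _ (hI t) _ (hGI t) (hFG t).1
        have h2 := hrad t ht
        have h3 := hGF t
        have h4 : K * τ ≤ K * τ / c * N.radius t := by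
          rw [div_mul_eq_mul_div, le_div_iff₀ hc]
          exact mul_le_mul_of_nonneg_left (hcr t ht) (by positivity)
        linarith) p q
    have h1 := N'.distIn_strip_radial_le hI' (hI p.1) (hGI p.1) hp
    have h3 := N'.distIn_strip_radial_le hI' (hGI q.1) (hI q.1) hq
    have a1 : |G p.1 - F p.1| ≤ K * τ := by
      rw [abs_of_nonneg (sub_nonneg.2 (hFG _).1)]; exact hGF _
    have a3 : |F q.1 - G q.1| ≤ K * τ := by
      rw [abs_sub_comm, abs_of_nonneg (sub_nonneg.2 (hFG _).1)]; exact hGF _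
    calc _ ≤ _ := N'.distIn_triangle _ _ (G p.1, p.2) _
      _ ≤ _ := add_le_add (h1.trans (ENNReal.ofReal_le_ofReal a1))
        ((N'.distIn_triangle _ _ (G q.1, q.2) _).trans
          (add_le_add h2 (h3.trans (ENNReal.ofReal_le_ofReal a3))))
  have hlim : Tendsto (fun τ : ℝ => ENNReal.ofReal (K * τ)
      + (ENNReal.ofReal (K + K * τ / c) * N.distIn (strip n I) p q + ENNReal.ofReal (K * τ)))
      (𝓝[>] 0) (𝓝 (ENNReal.ofReal (K * 0)
      + (ENNReal.ofReal (K + K * 0 / c) * N.distIn (strip n I) p q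
        + ENNReal.ofReal (K * 0)))) := by
    have t1 : Tendsto (fun τ : ℝ => ENNReal.ofReal (K * τ)) (𝓝[>] 0)
        (𝓝 (ENNReal.ofReal (K * 0))) :=
      (ENNReal.continuous_ofReal.comp (by fun_prop : Continuous fun τ : ℝ => K * τ)).continuousAt
        |>.tendsto.mono_left nhdsWithin_le_nhds
    have t2 : Tendsto (fun τ : ℝ => ENNReal.ofReal (K + K * τ / c)) (𝓝[>] 0)
        (𝓝 (ENNReal.ofReal (K + K * 0 / c))) :=
      (ENNReal.continuous_ofReal.comp (by fun_prop : Continuous fun τ : ℝ => K + K * τ / c)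
        ).continuousAt |>.tendsto.mono_left nhdsWithin_le_nhds
    exact t1.add ((ENNReal.Tendsto.mul_const t2 (Or.inr htop)).add t1)
  have h := ge_of_tendsto hlim (eventually_nhdsWithin_of_forall fun τ hτ => key τ hτ)
  simpa using h

end WarpedCylinder

/-! ### Bounds for the Lipschitz distance -/

theorem dil_le {X Y : Type*} {dX : X → X → ℝ≥0∞} {dY : Y → Y → ℝ≥0∞} {φ : X → Y} {K : ℝ≥0∞}
    (h : ∀ x y, dY (φ x) (φ y) ≤ K * dX x y) : dil dX dY φ ≤ K :=
  iSup_le fun x => iSup_le fun y => iSup_le fun _ => ENNReal.div_le_of_le_mul (h x y)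

/-- The bound for `log dil φ` from below needs a pair of points at a finite positive distance. -/
theorem abs_log_dil_le {X Y : Type*} {dX : X → X → ℝ≥0∞} {dY : Y → Y → ℝ≥0∞} {φ : X → Y}
    {K : ℝ} (hK : 0 < K) (h : ∀ x y, dY (φ x) (φ y) ≤ ENNReal.ofReal K * dX x y)
    (h' : ∀ x y, dX x y ≤ ENNReal.ofReal K * dY (φ x) (φ y)) {x y : X} (hxy : x ≠ y)
    (h0 : dX x y ≠ 0) (ht : dX x y ≠ ⊤) : |Real.log (dil dX dY φ).toReal| ≤ Real.log K := by
  have hle := dil_le h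
  have hfin : dil dX dY φ ≠ ⊤ := ne_top_of_le_ne_top ENNReal.ofReal_ne_top hle
  have h1 : (dil dX dY φ).toReal ≤ K :=
    ENNReal.toReal_le_of_le_ofReal hK.le hle
  have h2 : ENNReal.ofReal K⁻¹ ≤ dil dX dY φ := by
    refine le_trans ?_ (le_iSup_of_le x (le_iSup_of_le y (le_iSup_of_le hxy le_rfl)))
    rw [ENNReal.le_div_iff_mul_le (Or.inl h0) (Or.inl ht)]
    calc _ ≤ ENNReal.ofReal K⁻¹ * (ENNReal.ofReal K * dY (φ x) (φ y)) := by gcongr; exact h' x y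
      _ = dY (φ x) (φ y) := by
        rw [← mul_assoc, ← ENNReal.ofReal_mul (by positivity), inv_mul_cancel₀ hK.ne']
        simp
  have h3 : K⁻¹ ≤ (dil dX dY φ).toReal := (ENNReal.ofReal_le_iff_le_toReal hfin).1 h2
  have hpos : 0 < (dil dX dY φ).toReal := lt_of_lt_of_le (by positivity) h3
  rw [abs_le, ← Real.log_inv]
  exact ⟨Real.log_le_log (by positivity) h3, Real.log_le_log hpos h1⟩

theorem lipschitzDist_le {X Y : Type*} {dX : X → X → ℝ≥0∞} {dY : Y → Y → ℝ≥0∞} (φ : X ≃ Y)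
    {K : ℝ} (hK : 0 < K) (h : ∀ x y, dY (φ x) (φ y) ≤ ENNReal.ofReal K * dX x y)
    (h' : ∀ x y, dX (φ.symm x) (φ.symm y) ≤ ENNReal.ofReal K * dY x y) {x y : X} (hxy : x ≠ y)
    (h0 : dX x y ≠ 0) (ht : dX x y ≠ ⊤) :
    lipschitzDist dX dY ≤ ENNReal.ofReal (2 * Real.log K) := by
  refine (iInf₂_le φ ⟨ne_top_of_le_ne_top ENNReal.ofReal_ne_top (dil_le h),
    ne_top_of_le_ne_top ENNReal.ofReal_ne_top (dil_le h')⟩).trans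
    (ENNReal.ofReal_le_ofReal ?_)
  have hs : ∀ x y, dX x y ≤ ENNReal.ofReal K * dY (φ x) (φ y) := fun x y => by
    simpa using h' (φ x) (φ y)
  have b1 := abs_log_dil_le hK h hs hxy h0 ht
  have b2 : |Real.log (dil dY dX φ.symm).toReal| ≤ Real.log K := by
    refine abs_log_dil_le (x := φ x) (y := φ y) hK h'
      (fun u v => by simpa using h (φ.symm u) (φ.symm v)) (φ.injective.ne hxy) ?_ ?_
    · intro hz
      have := hs x y
      rw [hz, mul_zero] at this
      exact h0 (le_antisymm this zero_le)
    · exact ne_top_of_le_ne_top (ENNReal.mul_ne_top ENNReal.ofReal_ne_top ht) (h x y)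
  linarith

/-! ### Comparison of tubes -/

/-- The affine map that fixes `D` and has slope `(D + b') / (D + b)`; it maps `[-b, D]` onto
`[-b', D]`. -/
def stretch (D b b' t : ℝ) : ℝ := D + (D + b') / (D + b) * (t - D)

theorem stretch_stretch {D b b' : ℝ} (hb : D + b ≠ 0) (hb' : D + b' ≠ 0) (t : ℝ) :
    stretch D b' b (stretch D b b' t) = t := by
  rw [stretch, stretch]
  field_simp
  ring

theorem stretch_mono {D b b' : ℝ} (hb : 0 < D + b) (hb' : 0 < D + b') {u v : ℝ} (h : u ≤ v) :
    stretch D b b' u ≤ stretch D b b' v := by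
  have : 0 < (D + b') / (D + b) := by positivity
  simp only [stretch]
  nlinarith

theorem stretch_mem {D b b' : ℝ} (hb : 0 < D + b) (hb' : 0 < D + b') {t : ℝ}
    (ht : t ∈ Icc (-b) D) : stretch D b b' t ∈ Icc (-b') D := by
  have h1 := stretch_mono hb hb' ht.1
  have h2 := stretch_mono hb hb' ht.2
  have e1 : stretch D b b' (-b) = -b' := by rw [stretch]; field_simp; ring
  have e2 : stretch D b b' D = D := by simp [stretch]
  rw [e1] at h1
  rw [e2] at h2
  exact ⟨h1, h2⟩

theorem stretch_sub_le {D b b' K : ℝ} (hb : 0 < D + b) (hK : D + b' ≤ K * (D + b)) {u v : ℝ}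
    (h : u ≤ v) : stretch D b b' v - stretch D b b' u ≤ K * (v - u) := by
  have : (D + b') / (D + b) ≤ K := by rwa [div_le_iff₀ hb]
  simp only [stretch]
  nlinarith

theorem abs_stretch_sub_le {D b b' κ : ℝ} (hb : 0 < D + b) (hκ : |b - b'| ≤ κ) {t : ℝ}
    (ht : t ∈ Icc (-b) D) : |stretch D b b' t - t| ≤ κ := by
  have e : stretch D b b' t - t = (b - b') * ((D - t) / (D + b)) := by
    rw [stretch]; field_simp; ring
  have h1 : 0 ≤ (D - t) / (D + b) := div_nonneg (by linarith [ht.2]) hb.le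
  have h2 : (D - t) / (D + b) ≤ 1 := (div_le_one hb).2 (by linarith [ht.1])
  rw [e, abs_mul, abs_of_nonneg h1]
  exact (mul_le_of_le_one_right (abs_nonneg _) h2).trans hκ

/-- The nearest point of `[-b, D]`. -/
def clampTo (D b t : ℝ) : ℝ := max (min t D) (-b)

theorem clampTo_mem {D b : ℝ} (h : 0 ≤ D + b) (t : ℝ) : clampTo D b t ∈ Icc (-b) D :=
  ⟨le_max_right _ _, max_le (min_le_right _ _) (by linarith)⟩

theorem clampTo_of_mem {D b t : ℝ} (h : t ∈ Icc (-b) D) : clampTo D b t = t := by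
  rw [clampTo, min_eq_left h.2, max_eq_left h.1]

theorem clampTo_mono (D b : ℝ) : Monotone (clampTo D b) := fun _ _ h =>
  max_le_max (min_le_min h le_rfl) le_rfl

/-- Up to the level `D`, the variable splits into a clamped part, which is stretched, and an
overshoot below `-b`, which is translated. Increments of the two parts therefore add up to at most
the increment of `t`. -/
theorem clampTo_add_min {D b : ℝ} (h : 0 ≤ D + b) (t : ℝ) :
    clampTo D b t + min (t + b) 0 = min t D := by
  rw [clampTo]
  rcases le_total t (-b) with h1 | h1
  · rw [min_eq_left (by linarith : t ≤ D), max_eq_right h1, min_eq_left (by linarith)]; ring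
  · rw [max_eq_left (le_min h1 (by linarith)), min_eq_right (by linarith : 0 ≤ t + b), add_zero]

theorem min_sub_min_le {u v : ℝ} (D : ℝ) (h : u ≤ v) : min v D - min u D ≤ v - u := by
  rcases le_total u D with h1 | h1
  · rw [min_eq_left h1]; linarith [min_le_left v D]
  · rw [min_eq_right h1]; linarith [min_le_right v D]

/-- The stretching map, continued by translations below `-b`, constant above `D`, and cut off
at `-ℓ'`. -/
def stretchExt (D b b' ℓ' t : ℝ) : ℝ :=
  max (-ℓ') (stretch D b b' (clampTo D b t) + min (t + b) 0)

section

variable {D b b' ℓ ℓ' κ K : ℝ}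

theorem stretchExt_mono (hb : 0 < D + b) (hb' : 0 < D + b') :
    Monotone (stretchExt D b b' ℓ') := fun _ _ h =>
  max_le_max le_rfl (add_le_add (stretch_mono hb hb' (clampTo_mono D b h))
    (min_le_min (by linarith) le_rfl))

/-- The slope is at most `K` on the stretched piece, 1 below it and 0 above it; the cut-off does not
increase it. -/
theorem stretchExt_sub_le (hb : 0 < D + b) (hK1 : 1 ≤ K)
    (hK : D + b' ≤ K * (D + b)) {u v : ℝ} (h : u ≤ v) :
    stretchExt D b b' ℓ' v - stretchExt D b b' ℓ' u ≤ K * (v - u) := by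
  have h1 := stretch_sub_le hb hK (clampTo_mono D b h)
  have h2 : min (u + b) 0 ≤ min (v + b) 0 := min_le_min (by linarith) le_rfl
  have h3 := clampTo_add_min hb.le u
  have h4 := clampTo_add_min hb.le v
  have h5 := min_sub_min_le D h
  have h6 := clampTo_mono D b h
  have h7 : stretch D b b' (clampTo D b v) + min (v + b) 0
      ≤ stretch D b b' (clampTo D b u) + min (u + b) 0 + K * (v - u) := by
    nlinarith
  have h8 : 0 ≤ K * (v - u) := mul_nonneg (by linarith) (by linarith)
  have h9 := le_max_left (-ℓ') (stretch D b b' (clampTo D b u) + min (u + b) 0)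
  have h10 := le_max_right (-ℓ') (stretch D b b' (clampTo D b u) + min (u + b) 0)
  rw [stretchExt, stretchExt, sub_le_iff_le_add]
  exact max_le (by linarith) (by linarith)

theorem stretchExt_of_mem (hb : 0 < D + b) (hb' : 0 < D + b') (hℓ' : b' ≤ ℓ') {t : ℝ}
    (ht : t ∈ Icc (-b) D) : stretchExt D b b' ℓ' t = stretch D b b' t := by
  have := (stretch_mem hb hb' ht).1
  rw [stretchExt, clampTo_of_mem ht, min_eq_right (by linarith [ht.1]), add_zero,
    max_eq_right (by linarith)]

theorem stretchExt_mem (hb : 0 < D + b) (hb' : 0 < D + b') (hℓ' : b' ≤ ℓ') (t : ℝ) :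
    stretchExt D b b' ℓ' t ∈ Icc (-ℓ') D := by
  refine ⟨le_max_left _ _, max_le (by linarith) ?_⟩
  have := (stretch_mem hb hb' (clampTo_mem hb.le t)).2
  linarith [min_le_right (t + b) 0]

/-- Below `-b` the displacement is the one at `-b`, hence still at most `κ`. The cut-off lifts
points only to `-ℓ'`, which is at most `-ℓ + κ ≤ t + κ`. -/
theorem abs_stretchExt_sub_le (hb : 0 < D + b) (hκ : |b - b'| ≤ κ) (hκ' : |ℓ - ℓ'| ≤ κ) {t : ℝ}
    (ht : t ∈ Icc (-ℓ) D) : |stretchExt D b b' ℓ' t - t| ≤ κ := by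
  have h1 := abs_stretch_sub_le hb hκ (clampTo_mem hb.le t)
  have h2 := clampTo_add_min hb.le t
  rw [min_eq_left ht.2] at h2
  rw [abs_le] at *
  have h3 := le_max_right (-ℓ') (stretch D b b' (clampTo D b t) + min (t + b) 0)
  refine ⟨by rw [stretchExt]; linarith [h1.1], ?_⟩
  rw [stretchExt, sub_le_iff_le_add]
  exact max_le (by linarith [ht.1]) (by linarith)

end

/-! ### Close radius functions give nearly isometric tubes -/

namespace WarpedCylinder

variable {n : ℕ}

/-- The radius is monotone, grows at most at unit rate and is at least `c > 0`. -/
structure IsTame (N : WarpedCylinder) (c : ℝ) : Prop where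
  pos : 0 < c
  le_radius : ∀ s, N.start ≤ s → c ≤ N.radius s
  mono : ∀ u v, N.start ≤ u → u ≤ v → N.radius u ≤ N.radius v
  radius_le : ∀ u v, N.start ≤ u → u ≤ v → N.radius v ≤ N.radius u + (v - u)

/-- The spheres at `a ∈ N` and `a' ∈ N'` have distances `ℓ` and `ℓ'` to the boundaries that differ
at most by `κ`, and, up to the distance `D` outside of these spheres, the radii at corresponding
spheres differ at most by `η`. -/
structure AreClose (N N' : WarpedCylinder) (a a' D ℓ ℓ' κ η : ℝ) : Prop where
  start_eq : N.start = a - ℓ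
  start_eq' : N'.start = a' - ℓ'
  nonneg : 0 ≤ ℓ
  nonneg' : 0 ≤ ℓ'
  abs_sub_le : |ℓ - ℓ'| ≤ κ
  abs_radius_sub_le : ∀ t ∈ Icc (-ℓ) D, ∀ t' ∈ Icc (-ℓ') D, |t - t'| ≤ κ →
    |N.radius (a + t) - N'.radius (a' + t')| ≤ η

theorem AreClose.symm {N N' : WarpedCylinder} {a a' D ℓ ℓ' κ η : ℝ}
    (h : AreClose N N' a a' D ℓ ℓ' κ η) : AreClose N' N a' a D ℓ' ℓ κ η where
  start_eq := h.start_eq'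
  start_eq' := h.start_eq
  nonneg := h.nonneg'
  nonneg' := h.nonneg
  abs_sub_le := by rw [abs_sub_comm]; exact h.abs_sub_le
  abs_radius_sub_le := fun t ht t' ht' htt => by
    rw [abs_sub_comm]
    exact h.abs_radius_sub_le t' ht' t ht (by rwa [abs_sub_comm])

theorem abs_min_sub_min_le (u v D : ℝ) : |min u D - min v D| ≤ |u - v| := by
  simpa using abs_min_sub_min_le_max u D v D

/-- The stretching map of the tubes is `K`-Lipschitz, for the ambient distances and for the
intrinsic ones. -/
theorem AreClose.distIn_le {N N' : WarpedCylinder} {a a' D ℓ ℓ' κ η c K : ℝ}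
    (h : AreClose N N' a a' D ℓ ℓ' κ η) (hN : N.IsTame c) (hN' : N'.IsTame c) (hD : 0 < D)
    (hκ : 1 + κ / D ≤ K) (hη : 1 + η / c ≤ K) {p q : ℝ × EuclideanSpace ℝ (Fin n)}
    (hp : p ∈ strip n (Icc (a - min ℓ D) (a + D)))
    (hq : q ∈ strip n (Icc (a - min ℓ D) (a + D))) :
    N'.rdist (a' + stretch D (min ℓ D) (min ℓ' D) (p.1 - a), p.2)
        (a' + stretch D (min ℓ D) (min ℓ' D) (q.1 - a), q.2)
        ≤ ENNReal.ofReal K * N.rdist p q ∧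
      N'.distIn (strip n (Icc (a' - min ℓ' D) (a' + D)))
        (a' + stretch D (min ℓ D) (min ℓ' D) (p.1 - a), p.2)
        (a' + stretch D (min ℓ D) (min ℓ' D) (q.1 - a), q.2)
        ≤ ENNReal.ofReal K * N.distIn (strip n (Icc (a - min ℓ D) (a + D))) p q := by
  have hc := hN.pos
  set b := min ℓ D with hbdef
  set b' := min ℓ' D with hbdef'
  have hbℓ : b ≤ ℓ := min_le_left _ _
  have hbℓ' : b' ≤ ℓ' := min_le_left _ _
  have hb0 : 0 ≤ b := le_min h.nonneg hD.le
  have hb0' : 0 ≤ b' := le_min h.nonneg' hD.le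
  have hb : 0 < D + b := by linarith
  have hb' : 0 < D + b' := by linarith
  have hbκ : |b - b'| ≤ κ := (abs_min_sub_min_le ℓ ℓ' D).trans h.abs_sub_le
  have hκ0 : 0 ≤ κ := (abs_nonneg _).trans hbκ
  have hK1 : 1 ≤ K := by
    have : 0 ≤ κ / D := by positivity
    linarith
  have hK : D + b' ≤ K * (D + b) := by
    have h1 : κ ≤ (K - 1) * D := by
      rw [← div_le_iff₀ hD]; linarith
    have h2 : 0 ≤ (K - 1) * b := mul_nonneg (by linarith) hb0
    have h3 := (abs_le.1 hbκ).1
    nlinarith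
  -- An additive error `η` in the radius becomes a factor `K` because the radius is at least `c` and
  -- `η ≤ (K - 1) c`.
  have hrad : ∀ s ρ, N.start ≤ s → ρ ≤ N.radius s + η → ρ ≤ K * N.radius s := by
    intro s ρ hs hρ
    have h1 := hN.le_radius s hs
    have h2 : η ≤ (K - 1) * c := by
      rw [← div_le_iff₀ hc]; linarith
    have h3 : (K - 1) * c ≤ (K - 1) * N.radius s :=
      mul_le_mul_of_nonneg_left h1 (by linarith)
    linarith
  have hpt : p.1 - a ∈ Icc (-b) D := ⟨by linarith [hp.1.1], by linarith [hp.1.2]⟩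
  have hqt : q.1 - a ∈ Icc (-b) D := ⟨by linarith [hq.1.1], by linarith [hq.1.2]⟩
  constructor
  -- Ambient distances: almost shortest curves may leave the tube, so the map must be Lipschitz on
  -- the whole space.
  · have hF := distIn_strip_map_le (n := n) (N := N) (N' := N') (I := Ici N.start)
      (I' := Ici N'.start) (F := fun s => a' + stretchExt D b b' ℓ' (s - a)) (K := K) (c := c)
      (by linarith) ordConnected_Ici
      (fun u v huv => by
        have := stretchExt_mono (ℓ' := ℓ') hb hb' (sub_le_sub_right huv a)
        simpa using this)
      (fun u v huv => by
        have := stretchExt_sub_le (ℓ' := ℓ') hb hK1 hK (sub_le_sub_right huv a)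
        rw [sub_sub_sub_cancel_right] at this
        linarith)
      (fun t => by
        have := (stretchExt_mem hb hb' hbℓ' (t - a)).1
        rw [mem_Ici, h.start_eq']
        linarith)
      (fun s hs => by
        refine hrad s _ hs ?_
        have hs' : a - ℓ ≤ s := by rw [← h.start_eq]; exact hs
        -- Beyond `a + D` the map is constant and the source radius only grows, so the comparison at
        -- `a + D` suffices.
        have hle : N.radius (min s (a + D)) ≤ N.radius s :=
          hN.mono _ _ (le_min hs (by rw [h.start_eq]; linarith [h.nonneg])) (min_le_left _ _)
        have hcl : stretchExt D b b' ℓ' (s - a) = stretchExt D b b' ℓ' (min s (a + D) - a) := by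
          rcases le_total s (a + D) with h1 | h1
          · rw [min_eq_left h1]
          · rw [min_eq_right h1]
            simp only [stretchExt, clampTo]
            rw [min_eq_right (by linarith : D ≤ s - a), min_eq_right (by linarith : D ≤ a + D - a),
              min_eq_right (by linarith : 0 ≤ s - a + b),
              min_eq_right (by linarith : 0 ≤ a + D - a + b)]
        have ht : min s (a + D) - a ∈ Icc (-ℓ) D := by
          constructor
          · have : a - ℓ ≤ min s (a + D) := le_min hs' (by linarith [h.nonneg])
            linarith
          · linarith [min_le_right s (a + D)]
        have h1 := h.abs_radius_sub_le _ ht _ (stretchExt_mem hb hb' hbℓ' _)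
          (by rw [abs_sub_comm]; exact abs_stretchExt_sub_le hb hbκ h.abs_sub_le ht)
        rw [add_sub_cancel, ← hcl] at h1
        have := (abs_le.1 h1).1
        linarith)
      (fun t ht => hc.le.trans (hN'.le_radius t ht))
      (fun u hu v _ huv => hN'.radius_le u v hu huv) hc hN.le_radius hp.2 hq.2
    rw [stretchExt_of_mem hb hb' hbℓ' hpt, stretchExt_of_mem hb hb' hbℓ' hqt] at hF
    exact hF
  · have hst : ∀ s ∈ Icc (a - b) (a + D), N.start ≤ s := fun s hs => by
      rw [h.start_eq]; linarith [hs.1]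
    have hst' : ∀ s ∈ Icc (a' - b') (a' + D), N'.start ≤ s := fun s hs => by
      rw [h.start_eq']; linarith [hs.1]
    -- Intrinsic distances: curves stay in the tube. Clamping serves only to define the map on all
    -- of `ℝ`.
    have hF := distIn_strip_map_le (n := n) (N := N) (N' := N') (I := Icc (a - b) (a + D))
      (I' := Icc (a' - b') (a' + D))
      (F := fun s => a' + stretch D b b' (clampTo D b (s - a))) (K := K) (c := c)
      (by linarith) ordConnected_Icc
      (fun u v huv => by
        have := stretch_mono hb hb' (clampTo_mono D b (sub_le_sub_right huv a))
        simpa using this)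
      (fun u v huv => by
        have h1 := stretch_sub_le hb hK (clampTo_mono D b (sub_le_sub_right huv a))
        have h3 := clampTo_add_min hb.le (u - a)
        have h4 := clampTo_add_min hb.le (v - a)
        have h5 := min_sub_min_le D (sub_le_sub_right huv a)
        have h6 : min (u - a + b) 0 ≤ min (v - a + b) 0 := min_le_min (by linarith) le_rfl
        nlinarith)
      (fun t => by
        have := stretch_mem hb hb' (clampTo_mem hb.le (t - a))
        exact ⟨by linarith [this.1], by linarith [this.2]⟩)
      (fun s hs => by
        refine hrad s _ (hst s hs) ?_
        have ht : s - a ∈ Icc (-b) D := ⟨by linarith [hs.1], by linarith [hs.2]⟩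
        have hm := stretch_mem hb hb' ht
        have h1 := h.abs_radius_sub_le (s - a) ⟨by linarith [ht.1], ht.2⟩ _
          ⟨by linarith [hm.1], hm.2⟩
          (by rw [abs_sub_comm]; exact abs_stretch_sub_le hb hbκ ht)
        rw [add_sub_cancel] at h1
        rw [clampTo_of_mem ht]
        have := (abs_le.1 h1).1
        linarith)
      (fun t ht => hc.le.trans (hN'.le_radius t (hst' t ht)))
      (fun u hu v _ huv => hN'.radius_le u v (hst' u hu) huv) hc
      (fun s hs => hN.le_radius s (hst s hs)) hp.2 hq.2
    rw [clampTo_of_mem hpt, clampTo_of_mem hqt] at hF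
    exact hF

/-- Distances dominate differences of the radial coordinate, and radial segments attain them. The
tube extends inward by `D` or to the boundary, whichever comes first. -/
theorem tube_eq_strip (N : WarpedCylinder) {a ℓ D : ℝ} (hst : N.start = a - ℓ) (hℓ : 0 ≤ ℓ)
    (hD : 0 ≤ D) : N.tube D (strip n {a}) = strip n (Icc (a - min ℓ D) (a + D)) := by
  ext ⟨s, θ⟩
  simp only [tube, mem_ofPred_eq, carrier, strip, mem_Icc, mem_singleton_iff, hst]
  constructor
  · rintro ⟨⟨h1, h2⟩, h3⟩
    have h4 : ENNReal.ofReal |s - a| ≤ ENNReal.ofReal D := by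
      refine le_trans (le_iInf₂ fun q hq => ?_) h3
      have := N.ofReal_abs_sub_le_distIn (N.carrier n) (s, θ) q
      rw [hq.1, abs_sub_comm] at this
      exact this
    rw [ENNReal.ofReal_le_ofReal_iff hD, abs_le] at h4
    refine ⟨⟨?_, by linarith⟩, h2⟩
    rcases le_total ℓ D with h | h
    · rw [min_eq_left h]; exact h1
    · rw [min_eq_right h]; linarith
  · rintro ⟨⟨h1, h3⟩, h2⟩
    have hs : a - ℓ ≤ s := by linarith [min_le_left ℓ D]
    refine ⟨⟨hs, h2⟩, (iInf₂_le (a, θ) ⟨rfl, h2⟩).trans ?_⟩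
    refine (N.distIn_strip_radial_le (I := Ici N.start) ordConnected_Ici (by rw [hst]; exact hs)
      (by rw [hst, mem_Ici]; linarith) h2).trans (ENNReal.ofReal_le_ofReal ?_)
    rw [abs_le]
    exact ⟨by linarith, by linarith [min_le_right ℓ D]⟩

/-- The stretching map of the tubes. -/
def stretchEquiv {a a' D b b' : ℝ} (hb : 0 < D + b) (hb' : 0 < D + b') :
    strip n (Icc (a - b) (a + D)) ≃ strip n (Icc (a' - b') (a' + D)) where
  toFun p := ⟨(a' + stretch D b b' (p.1.1 - a), p.1.2), by
    have := stretch_mem hb hb' (t := p.1.1 - a)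
      ⟨by linarith [p.2.1.1], by linarith [p.2.1.2]⟩
    exact ⟨⟨by linarith [this.1], by linarith [this.2]⟩, p.2.2⟩⟩
  invFun p := ⟨(a + stretch D b' b (p.1.1 - a'), p.1.2), by
    have := stretch_mem hb' hb (t := p.1.1 - a')
      ⟨by linarith [p.2.1.1], by linarith [p.2.1.2]⟩
    exact ⟨⟨by linarith [this.1], by linarith [this.2]⟩, p.2.2⟩⟩
  left_inv p := by
    ext1; ext1
    · simp [stretch_stretch hb.ne' hb'.ne']
    · rfl
  right_inv p := by
    ext1; ext1
    · simp [stretch_stretch hb'.ne' hb.ne']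
    · rfl

/-- Closeness is symmetric and the inverse of the stretching is the stretching with `b` and `b'`
exchanged, so one estimate serves both directions. Two points on one ray provide the pair at finite
positive distance. -/
theorem AreClose.lipDist_le (hn : 0 < n) {N N' : WarpedCylinder} {a a' D ℓ ℓ' κ η c K : ℝ}
    (h : AreClose N N' a a' D ℓ ℓ' κ η) (hN : N.IsTame c) (hN' : N'.IsTame c) (hD : 0 < D)
    (hκ : 1 + κ / D ≤ K) (hη : 1 + η / c ≤ K) :
    restrictedLipDist N N' (N.tube D (strip n {a})) (N'.tube D (strip n {a'}))
        ≤ ENNReal.ofReal (2 * Real.log K) ∧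
      intrinsicLipDist N N' (N.tube D (strip n {a})) (N'.tube D (strip n {a'}))
        ≤ ENNReal.ofReal (2 * Real.log K) := by
  rw [N.tube_eq_strip h.start_eq h.nonneg hD.le, N'.tube_eq_strip h.start_eq' h.nonneg' hD.le]
  have hκ0 : 0 ≤ κ := (abs_nonneg _).trans h.abs_sub_le
  have hK : 0 < K := by
    have : 0 ≤ κ / D := by positivity
    linarith
  have hb0 : 0 ≤ min ℓ D := le_min h.nonneg hD.le
  have hb : 0 < D + min ℓ D := by linarith
  have hb' : 0 < D + min ℓ' D := by linarith [le_min h.nonneg' hD.le]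
  have h1 := fun p q hp hq => h.distIn_le (n := n) hN hN' hD hκ hη (p := p) (q := q) hp hq
  have h2 := fun p q hp hq => h.symm.distIn_le (n := n) hN' hN hD hκ hη (p := p) (q := q) hp hq
  obtain ⟨θ, hθ⟩ : ∃ θ : EuclideanSpace ℝ (Fin n), ‖θ‖ = 1 :=
    ⟨EuclideanSpace.single ⟨0, hn⟩ 1, by simp⟩
  have hI : (Icc (a - min ℓ D) (a + D)).OrdConnected := ordConnected_Icc
  have hx : a + D ∈ Icc (a - min ℓ D) (a + D) := ⟨by linarith, le_rfl⟩
  have hy : a ∈ Icc (a - min ℓ D) (a + D) := ⟨by linarith, by linarith⟩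
  have hsub : Icc (a - min ℓ D) (a + D) ⊆ Ici N.start := fun s hs => by
    rw [h.start_eq, mem_Ici]; linarith [hs.1, min_le_left ℓ D]
  have hne : (⟨(a + D, θ), hx, hθ⟩ : strip n (Icc (a - min ℓ D) (a + D))) ≠ ⟨(a, θ), hy, hθ⟩ := by
    intro he
    have := congrArg (fun p => p.1.1) he
    simp only at this
    linarith
  have hpos : ∀ U, N.distIn U (a + D, θ) (a, θ) ≠ 0 := fun U h0 => by
    have := N.ofReal_abs_sub_le_distIn U (a + D, θ) (a, θ)
    rw [h0, nonpos_iff_eq_zero, ENNReal.ofReal_eq_zero] at this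
    have h3 := abs_nonpos_iff.1 this
    simp only at h3
    linarith
  constructor
  · exact lipschitzDist_le (stretchEquiv hb hb') hK (fun p q => (h1 p.1 q.1 p.2 q.2).1)
      (fun p q => (h2 p.1 q.1 p.2 q.2).1) hne (hpos _)
      (ne_top_of_le_ne_top ENNReal.ofReal_ne_top
        (N.distIn_strip_radial_le ordConnected_Ici (hsub hx) (hsub hy) hθ))
  · exact lipschitzDist_le (stretchEquiv hb hb') hK (fun p q => (h1 p.1 q.1 p.2 q.2).2)
      (fun p q => (h2 p.1 q.1 p.2 q.2).2) hne (hpos _)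
      (ne_top_of_le_ne_top ENNReal.ofReal_ne_top (N.distIn_strip_radial_le hI hx hy hθ))

end WarpedCylinder

/-! ### Schwarzschild spaces -/

/-- The primitive of a function on a half-line that is integrable up to the endpoint. -/
theorem continuousOn_primitive_Ici {f : ℝ → ℝ} {a : ℝ}
    (h : ∀ b, a ≤ b → IntervalIntegrable f volume a b) :
    ContinuousOn (fun x => ∫ t in a..x, f t) (Ici a) := by
  intro x hx
  have hx' : a ≤ x := hx
  have h1 := intervalIntegral.continuousOn_primitive_interval' (h (x + 1) (by linarith))
    left_mem_uIcc
  rw [uIcc_of_le (by linarith : a ≤ x + 1)] at h1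
  refine (h1 x ⟨hx', by linarith⟩).mono_of_mem_nhdsWithin ?_
  have : Iio (x + 1) ∈ 𝓝 x := Iio_mem_nhds (by linarith)
  filter_upwards [self_mem_nhdsWithin, mem_nhdsWithin_of_mem_nhds this] with y h1 h2
  exact ⟨h1, le_of_lt h2⟩

theorem hasDerivAt_primitive_Ioi {f : ℝ → ℝ} {a x : ℝ}
    (h : ∀ b, a ≤ b → IntervalIntegrable f volume a b) (hf : ContinuousOn f (Ioi a))
    (hx : a < x) : HasDerivAt (fun x => ∫ t in a..x, f t) (f x) x :=
  intervalIntegral.integral_hasDerivAt_right (h x hx.le)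
    (hf.stronglyMeasurableAtFilter isOpen_Ioi x hx) (hf.continuousAt (Ioi_mem_nhds hx))

section Schwarzschild

variable {n : ℕ} {m : ℝ}

theorem natCast_sub_two (hn : 3 ≤ n) : ((n - 2 : ℕ) : ℝ) = (n : ℝ) - 2 := by
  rw [Nat.cast_sub (by omega)]; norm_num

theorem rpow_inv_pow_sub_two (hn : 3 ≤ n) {x : ℝ} (hx : 0 ≤ x) :
    (x ^ (((n : ℝ) - 2)⁻¹)) ^ (n - 2) = x := by
  rw [← natCast_sub_two hn]
  exact Real.rpow_inv_natCast_pow hx (by omega)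

theorem horizonRadius_pos (hm : 0 < m) : 0 < horizonRadius n m :=
  Real.rpow_pos_of_pos (by linarith) _

theorem horizonRadius_pow (hn : 3 ≤ n) (hm : 0 < m) : horizonRadius n m ^ (n - 2) = 2 * m :=
  rpow_inv_pow_sub_two hn (by linarith)

theorem lt_pow_of_horizonRadius_lt (hn : 3 ≤ n) (hm : 0 < m) {t : ℝ}
    (ht : horizonRadius n m < t) : 2 * m < t ^ (n - 2) := by
  rw [← horizonRadius_pow hn hm]
  exact pow_lt_pow_left₀ ht (horizonRadius_pos hm).le (by omega)

theorem schwarzschild_lapse_pos (hn : 3 ≤ n) (hm : 0 < m) {t : ℝ}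
    (ht : horizonRadius n m < t) : 0 < 1 - 2 * m / t ^ (n - 2) := by
  have := lt_pow_of_horizonRadius_lt hn hm ht
  rw [sub_pos, div_lt_one (by linarith)]
  exact this

theorem schwarzschild_lapse_lt_one (hm : 0 < m) {t : ℝ}
    (ht : 0 < t) : 1 - 2 * m / t ^ (n - 2) < 1 := by
  have : 0 < 2 * m / t ^ (n - 2) := by positivity
  linarith

/-- As `r₀ / t < 1` and `n - 2 ≥ 1`, one has `(r₀ / t)ⁿ⁻² ≤ r₀ / t`, with `r₀` the horizon radius.
So the lapse vanishes at most linearly at the horizon, and the arclength integrand has an integrable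
singularity of order `(t - r₀)^(-1/2)`. -/
theorem div_le_schwarzschild_lapse (hn : 3 ≤ n) (hm : 0 < m) {t : ℝ}
    (ht : horizonRadius n m < t) : (t - horizonRadius n m) / t ≤ 1 - 2 * m / t ^ (n - 2) := by
  have h0 := horizonRadius_pos (n := n) hm
  have ht0 : 0 < t := h0.trans ht
  rw [← horizonRadius_pow hn hm, ← div_pow, sub_div, div_self ht0.ne']
  have : (horizonRadius n m / t) ^ (n - 2) ≤ horizonRadius n m / t :=
    pow_le_of_le_one (by positivity) ((div_le_one ht0).2 ht.le) (by omega)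
  linarith

theorem intervalIntegrable_schwarzschildArclength (hn : 3 ≤ n) (hm : 0 < m) (ρ : ℝ)
    (hρ : horizonRadius n m ≤ ρ) :
    IntervalIntegrable (fun t => (√(1 - 2 * m / t ^ (n - 2)))⁻¹) volume (horizonRadius n m) ρ := by
  set r₀ := horizonRadius n m
  have h0 : 0 < r₀ := horizonRadius_pos hm
  have h1 : IntervalIntegrable (fun t : ℝ => √ρ * (t - r₀) ^ (-(1 / 2) : ℝ)) volume r₀ ρ := by
    have := (intervalIntegral.intervalIntegrable_rpow' (a := 0) (b := ρ - r₀)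
      (r := -(1 / 2)) (by norm_num)).comp_sub_right r₀
    rw [zero_add, sub_add_cancel] at this
    exact this.const_mul _
  refine h1.mono_fun (Measurable.aestronglyMeasurable (by fun_prop)) ?_
  rw [uIoc_of_le hρ]
  filter_upwards [ae_restrict_mem measurableSet_Ioc] with t ht
  have ht0 : 0 < t := h0.trans ht.1
  have hd : 0 < t - r₀ := sub_pos.2 ht.1
  have hl := div_le_schwarzschild_lapse hn hm ht.1
  have hp : 0 < (t - r₀) / t := by positivity
  have e : √ρ * (t - r₀) ^ (-(1 / 2) : ℝ) = √ρ * (√(t - r₀))⁻¹ := by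
    rw [Real.rpow_neg hd.le, ← Real.sqrt_eq_rpow]
  rw [e, Real.norm_of_nonneg (by positivity), Real.norm_of_nonneg (by positivity)]
  calc (√(1 - 2 * m / t ^ (n - 2)))⁻¹ ≤ (√((t - r₀) / t))⁻¹ :=
        inv_anti₀ (Real.sqrt_pos.2 hp) (Real.sqrt_le_sqrt hl)
    _ = √t * (√(t - r₀))⁻¹ := by
        rw [Real.sqrt_div hd.le, inv_div, div_eq_mul_inv]
    _ ≤ √ρ * (√(t - r₀))⁻¹ :=
        mul_le_mul_of_nonneg_right (Real.sqrt_le_sqrt ht.2) (by positivity)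

theorem continuousOn_schwarzschildArclength (hn : 3 ≤ n) (hm : 0 < m) :
    ContinuousOn (schwarzschildArclength n m) (Ici (horizonRadius n m)) :=
  continuousOn_primitive_Ici (intervalIntegrable_schwarzschildArclength hn hm)

theorem continuousOn_schwarzschild_lapse (hm : 0 < m) :
    ContinuousOn (fun t : ℝ => 1 - 2 * m / t ^ (n - 2)) (Ioi (horizonRadius n m)) := by
  refine continuousOn_const.sub (continuousOn_const.div (by fun_prop) fun t ht => ?_)
  have := (horizonRadius_pos (n := n) hm).trans ht
  positivity

theorem hasDerivAt_schwarzschildArclength (hn : 3 ≤ n) (hm : 0 < m) {ρ : ℝ}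
    (hρ : horizonRadius n m < ρ) :
    HasDerivAt (schwarzschildArclength n m) (√(1 - 2 * m / ρ ^ (n - 2)))⁻¹ ρ := by
  refine hasDerivAt_primitive_Ioi (intervalIntegrable_schwarzschildArclength hn hm) ?_ hρ
  exact (continuousOn_schwarzschild_lapse hm).sqrt.inv₀ fun t ht =>
    (Real.sqrt_pos.2 (schwarzschild_lapse_pos hn hm ht)).ne'

/-- The integrand is at least 1. Consequently arclength is strictly increasing and the radius as a
function of arclength is 1-Lipschitz. -/
theorem sub_le_schwarzschildArclength_sub (hn : 3 ≤ n) (hm : 0 < m) {u v : ℝ}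
    (hu : horizonRadius n m ≤ u) (huv : u ≤ v) :
    v - u ≤ schwarzschildArclength n m v - schwarzschildArclength n m u := by
  have h : MonotoneOn (fun ρ => schwarzschildArclength n m ρ - ρ) (Ici (horizonRadius n m)) := by
    refine monotoneOn_of_hasDerivWithinAt_nonneg (convex_Ici _)
      ((continuousOn_schwarzschildArclength hn hm).sub continuousOn_id)
      (f' := fun ρ => (√(1 - 2 * m / ρ ^ (n - 2)))⁻¹ - 1) (fun x hx => ?_) (fun x hx => ?_)
    · rw [interior_Ici] at hx
      exact ((hasDerivAt_schwarzschildArclength hn hm hx).sub (hasDerivAt_id x)).hasDerivWithinAt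
    · rw [interior_Ici] at hx
      have h1 := schwarzschild_lapse_pos hn hm hx
      have h2 := schwarzschild_lapse_lt_one (n := n) hm ((horizonRadius_pos hm).trans hx)
      rw [sub_nonneg]
      exact (one_le_inv₀ (Real.sqrt_pos.2 h1)).2 (Real.sqrt_le_one.2 h2.le)
  have := h hu (hu.trans huv) huv
  simp only at this
  linarith

theorem schwarzschildArclength_horizonRadius :
    schwarzschildArclength n m (horizonRadius n m) = 0 := intervalIntegral.integral_same

theorem sub_le_schwarzschildArclength (hn : 3 ≤ n) (hm : 0 < m) {ρ : ℝ}
    (hρ : horizonRadius n m ≤ ρ) : ρ - horizonRadius n m ≤ schwarzschildArclength n m ρ := by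
  simpa [schwarzschildArclength_horizonRadius] using
    sub_le_schwarzschildArclength_sub hn hm le_rfl hρ

theorem schwarzschildArclength_strictMonoOn (hn : 3 ≤ n) (hm : 0 < m) :
    StrictMonoOn (schwarzschildArclength n m) (Ici (horizonRadius n m)) := fun u hu v _ huv => by
  linarith [sub_le_schwarzschildArclength_sub hn hm hu huv.le]

theorem schwarzschildArclength_surjOn (hn : 3 ≤ n) (hm : 0 < m) :
    SurjOn (schwarzschildArclength n m) (Ici (horizonRadius n m)) (Ici 0) := by
  intro s hs
  have hs' : (0 : ℝ) ≤ s := hs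
  have hc := (continuousOn_schwarzschildArclength hn hm).mono
    (Icc_subset_Ici_self : Icc _ (horizonRadius n m + s) ⊆ _)
  have h := intermediate_value_Icc (by linarith) hc
  have h1 := sub_le_schwarzschildArclength hn hm
    (by linarith : horizonRadius n m ≤ horizonRadius n m + s)
  rw [schwarzschildArclength_horizonRadius] at h
  obtain ⟨ρ, hρ, he⟩ := h ⟨hs', by linarith⟩
  exact ⟨ρ, hρ.1, he⟩

/-- This characterizes the radius uniformly on both pieces: the glued cylinder counts as arclength
0, whence `max s 0`. -/
theorem appendedSchwarzschild_radius_spec (hn : 3 ≤ n) (hm : 0 < m) (L s : ℝ) :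
    horizonRadius n m ≤ (appendedSchwarzschild n m L).radius s ∧
      schwarzschildArclength n m ((appendedSchwarzschild n m L).radius s) = max s 0 := by
  simp only [appendedSchwarzschild]
  split_ifs with h
  · exact ⟨le_rfl, by rw [schwarzschildArclength_horizonRadius, max_eq_right h]⟩
  · push Not at h
    have h1 := schwarzschildArclength_surjOn hn hm (show s ∈ Ici 0 from h.le)
    refine ⟨Function.invFunOn_mem h1, ?_⟩
    rw [max_eq_left h.le]
    exact Function.invFunOn_eq h1

theorem appendedSchwarzschild_radius_arclength (hn : 3 ≤ n) (hm : 0 < m) (L : ℝ) {ρ : ℝ}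
    (hρ : horizonRadius n m ≤ ρ) :
    (appendedSchwarzschild n m L).radius (schwarzschildArclength n m ρ) = ρ := by
  obtain ⟨h1, h2⟩ := appendedSchwarzschild_radius_spec hn hm L (schwarzschildArclength n m ρ)
  have h3 := sub_le_schwarzschildArclength hn hm hρ
  rw [max_eq_left (by linarith)] at h2
  exact (schwarzschildArclength_strictMonoOn hn hm).injOn h1 hρ h2

theorem appendedSchwarzschild_radius_mono (hn : 3 ≤ n) (hm : 0 < m) (L : ℝ) :
    Monotone (appendedSchwarzschild n m L).radius := fun u v huv => by
  obtain ⟨h1, h2⟩ := appendedSchwarzschild_radius_spec hn hm L u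
  obtain ⟨h3, h4⟩ := appendedSchwarzschild_radius_spec hn hm L v
  rw [← (schwarzschildArclength_strictMonoOn hn hm).le_iff_le h1 h3, h2, h4]
  exact max_le_max huv le_rfl

theorem appendedSchwarzschild_radius_le_add (hn : 3 ≤ n) (hm : 0 < m) (L : ℝ) {u v : ℝ}
    (huv : u ≤ v) : (appendedSchwarzschild n m L).radius v
      ≤ (appendedSchwarzschild n m L).radius u + (v - u) := by
  obtain ⟨h1, h2⟩ := appendedSchwarzschild_radius_spec hn hm L u
  obtain ⟨h3, h4⟩ := appendedSchwarzschild_radius_spec hn hm L v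
  have h5 := sub_le_schwarzschildArclength_sub hn hm h1
    (appendedSchwarzschild_radius_mono hn hm L huv)
  rw [h2, h4] at h5
  have h6 : max v 0 - max u 0 ≤ v - u := by
    rcases le_total u 0 with h | h
    · rw [max_eq_right h]
      rcases le_total v 0 with h' | h'
      · rw [max_eq_right h']; linarith
      · rw [max_eq_left h']; linarith
    · rw [max_eq_left h, max_eq_left (h.trans huv)]
  linarith

theorem abs_appendedSchwarzschild_radius_sub_le (hn : 3 ≤ n) (hm : 0 < m) (L u v : ℝ) :
    |(appendedSchwarzschild n m L).radius u - (appendedSchwarzschild n m L).radius v|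
      ≤ |u - v| := by
  rcases le_total u v with h | h
  · rw [abs_sub_comm, abs_sub_comm u, abs_of_nonneg (sub_nonneg.2 h),
      abs_of_nonneg (sub_nonneg.2 (appendedSchwarzschild_radius_mono hn hm L h))]
    linarith [appendedSchwarzschild_radius_le_add hn hm L h]
  · rw [abs_of_nonneg (sub_nonneg.2 h),
      abs_of_nonneg (sub_nonneg.2 (appendedSchwarzschild_radius_mono hn hm L h))]
    linarith [appendedSchwarzschild_radius_le_add hn hm L h]

theorem appendedSchwarzschild_isTame (hn : 3 ≤ n) (hm : 0 < m) (L : ℝ) :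
    (appendedSchwarzschild n m L).IsTame (horizonRadius n m) where
  pos := horizonRadius_pos hm
  le_radius s _ := (appendedSchwarzschild_radius_spec hn hm L s).1
  mono _ _ _ h := appendedSchwarzschild_radius_mono hn hm L h
  radius_le _ _ _ h := appendedSchwarzschild_radius_le_add hn hm L h

/-- This is `dz ≤ ds`: squared, the two sides are `2m / (tⁿ⁻² - 2m)` and `tⁿ⁻² / (tⁿ⁻² - 2m)`. -/
theorem schwarzschildHeight_integrand_le (hn : 3 ≤ n) (hm : 0 < m) {t : ℝ}
    (ht : horizonRadius n m < t) :
    √(2 * m / (t ^ (n - 2) - 2 * m)) ≤ (√(1 - 2 * m / t ^ (n - 2)))⁻¹ := by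
  have h1 := lt_pow_of_horizonRadius_lt hn hm ht
  rw [← Real.sqrt_inv]
  refine Real.sqrt_le_sqrt ?_
  have h2 : (1 - 2 * m / t ^ (n - 2))⁻¹ = t ^ (n - 2) / (t ^ (n - 2) - 2 * m) := by
    rw [one_sub_div (by linarith), inv_div]
  rw [h2]
  gcongr

theorem intervalIntegrable_schwarzschildHeight (hn : 3 ≤ n) (hm : 0 < m) (ρ : ℝ)
    (hρ : horizonRadius n m ≤ ρ) :
    IntervalIntegrable (fun t => √(2 * m / (t ^ (n - 2) - 2 * m))) volume
      (horizonRadius n m) ρ := by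
  refine (intervalIntegrable_schwarzschildArclength hn hm ρ hρ).mono_fun
    (Measurable.aestronglyMeasurable (by fun_prop)) ?_
  rw [uIoc_of_le hρ]
  filter_upwards [ae_restrict_mem measurableSet_Ioc] with t ht
  rw [Real.norm_of_nonneg (by positivity), Real.norm_of_nonneg (by positivity)]
  exact schwarzschildHeight_integrand_le hn hm ht.1

theorem schwarzschildHeight_le_arclength (hn : 3 ≤ n) (hm : 0 < m) {ρ : ℝ}
    (hρ : horizonRadius n m ≤ ρ) :
    schwarzschildHeight n m ρ ≤ schwarzschildArclength n m ρ := by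
  refine intervalIntegral.integral_mono_on_of_le_Ioo hρ
    (intervalIntegrable_schwarzschildHeight hn hm ρ hρ)
    (intervalIntegrable_schwarzschildArclength hn hm ρ hρ) fun t ht => ?_
  exact schwarzschildHeight_integrand_le hn hm ht.1

theorem continuousOn_schwarzschildHeight (hn : 3 ≤ n) (hm : 0 < m) :
    ContinuousOn (schwarzschildHeight n m) (Ici (horizonRadius n m)) :=
  continuousOn_primitive_Ici (intervalIntegrable_schwarzschildHeight hn hm)

theorem hasDerivAt_schwarzschildHeight (hn : 3 ≤ n) (hm : 0 < m) {ρ : ℝ}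
    (hρ : horizonRadius n m < ρ) :
    HasDerivAt (schwarzschildHeight n m) (√(2 * m / (ρ ^ (n - 2) - 2 * m))) ρ := by
  refine hasDerivAt_primitive_Ioi (intervalIntegrable_schwarzschildHeight hn hm) ?_ hρ
  refine (continuousOn_const.div (by fun_prop) fun t ht => ?_).sqrt
  exact (sub_pos.2 (lt_pow_of_horizonRadius_lt hn hm ht)).ne'

end Schwarzschild

/-! ### Rotationally symmetric manifolds: the Hawking mass -/

theorem unitSphereArea_pos {n : ℕ} (hn : 0 < n) : 0 < unitSphereArea n := by
  have : Nontrivial (EuclideanSpace ℝ (Fin n)) := by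
    have : Nonempty (Fin n) := ⟨⟨0, hn⟩⟩
    infer_instance
  rw [unitSphereArea, Measure.toSphere_apply_univ]
  refine ENNReal.toReal_pos ?_ ?_
  · simp [hn.ne', (Metric.measure_ball_pos volume (0 : EuclideanSpace ℝ (Fin n)) one_pos).ne']
  · exact ENNReal.mul_ne_top (by simp) measure_ball_lt_top.ne

namespace RotSymBdry

variable {n : ℕ} (M : RotSymBdry n)

theorem hasDerivAt_r {s : ℝ} (hs : 0 < s) : HasDerivAt M.r (deriv M.r s) s :=
  ((M.smooth.differentiableOn (by simp)).differentiableAt (Ici_mem_nhds hs)).hasDerivAt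

theorem contDiffOn_deriv_r : ContDiffOn ℝ 1 (deriv M.r) (Ioi 0) :=
  (M.smooth.mono Ioi_subset_Ici_self).deriv_of_isOpen isOpen_Ioi (by norm_cast)

theorem hasDerivAt_deriv_r {s : ℝ} (hs : 0 < s) :
    HasDerivAt (deriv M.r) (deriv (deriv M.r) s) s :=
  ((M.contDiffOn_deriv_r.differentiableOn one_ne_zero).differentiableAt
    (Ioi_mem_nhds hs)).hasDerivAt

theorem derivWithin_r {s : ℝ} (hs : 0 < s) : derivWithin M.r (Ici 0) s = deriv M.r s :=
  derivWithin_of_mem_nhds (Ici_mem_nhds hs)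

theorem derivWithin_sphereArea {s : ℝ} (hs : 0 ≤ s) :
    derivWithin (WarpedCylinder.sphereArea ⟨0, M.r⟩ n) (Ici 0) s
      = unitSphereArea n * (((n - 1 : ℕ) : ℝ) * M.r s ^ (n - 1 - 1)
        * derivWithin M.r (Ici 0) s) := by
  have h : HasDerivWithinAt M.r (derivWithin M.r (Ici 0) s) (Ici 0) s :=
    (M.smooth.differentiableOn (by simp) s hs).hasDerivWithinAt
  exact ((h.fun_pow (n - 1)).const_mul _).derivWithin (uniqueDiffOn_Ici 0 s hs)

theorem derivWithin_r_zero (hn : 3 ≤ n) : derivWithin M.r (Ici 0) 0 = 0 := by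
  have h := M.boundary_minimal
  rw [M.derivWithin_sphereArea le_rfl] at h
  have h1 := M.pos 0 le_rfl
  have h2 : ((n - 1 : ℕ) : ℝ) ≠ 0 := by norm_cast; omega
  simpa [(unitSphereArea_pos (by omega : 0 < n)).ne', h2, h1.ne'] using h

/-- The boundary being outermost, `r'` has no zero for `s > 0`, hence a constant sign by Darboux's
theorem. A negative sign would contradict that the boundary is outer-minimizing. -/
theorem deriv_r_pos (hn : 3 ≤ n) {s : ℝ} (hs : 0 < s) : 0 < deriv M.r s := by
  have hne : ∀ x ∈ Ioi (0 : ℝ), deriv M.r x ≠ 0 := fun x hx h0 => by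
    have hx' : 0 < x := hx
    refine M.boundary_outermost x hx' ?_
    rw [M.derivWithin_sphereArea hx'.le, M.derivWithin_r hx', h0]
    ring
  rcases hasDerivWithinAt_forall_lt_or_forall_gt_of_forall_ne (convex_Ioi (0 : ℝ))
    (fun x hx => (M.hasDerivAt_r hx).hasDerivWithinAt) hne with h | h
  · exfalso
    have hanti : StrictAntiOn M.r (Ici 0) :=
      strictAntiOn_of_deriv_neg (convex_Ici 0) M.smooth.continuousOn fun x hx => by
        rw [interior_Ici] at hx; exact h x hx
    have h1 : M.r 1 < M.r 0 := hanti self_mem_Ici (by simp : (1 : ℝ) ∈ Ici 0) one_pos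
    have h2 := M.boundary_outerMinimizing 1 one_pos
    have h3 : M.r 1 ^ (n - 1) < M.r 0 ^ (n - 1) :=
      pow_lt_pow_left₀ h1 (M.pos 1 zero_le_one).le (by omega)
    exact absurd h2 (not_le.2 (mul_lt_mul_of_pos_left h3 (unitSphereArea_pos (by omega))))
  · exact h s hs

theorem strictMonoOn_r (hn : 3 ≤ n) : StrictMonoOn M.r (Ici 0) :=
  strictMonoOn_of_deriv_pos (convex_Ici 0) M.smooth.continuousOn fun x hx => by
    rw [interior_Ici] at hx; exact M.deriv_r_pos hn hx

theorem two_mul_deriv_deriv_r_le (hn : 3 ≤ n) {s : ℝ} (hs : 0 < s) :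
    2 * M.r s * deriv (deriv M.r) s ≤ ((n : ℝ) - 2) * (1 - deriv M.r s ^ 2) := by
  set x : EuclideanSpace ℝ (Fin n) := EuclideanSpace.single ⟨0, by omega⟩ (1 + s)
  have hx : ‖x‖ = 1 + s := by
    simp only [x, PiLp.norm_single, Real.norm_eq_abs]
    exact abs_of_pos (by linarith)
  have hx1 : 1 < ‖x‖ := by linarith
  have hxs : ‖x‖ - 1 = s := by rw [hx]; ring
  have h := M.scalarCurvature_nonneg x hx1
  rw [scalarCurvature_rotMetricCoeff hx1 (fun t ht => M.pos t ht.le)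
    (fun t ht => M.hasDerivAt_r ht) (by rw [hxs]; exact M.hasDerivAt_deriv_r hs), hxs] at h
  have hr := M.pos s hs.le
  have hn1 : (0 : ℝ) < n - 1 := by
    have : (3 : ℝ) ≤ n := by exact_mod_cast hn
    linarith
  have h2 := nonneg_of_mul_nonneg_right h hn1
  have e : ((n : ℝ) - 2) * (1 - deriv M.r s ^ 2) / M.r s ^ 2 - 2 * deriv (deriv M.r) s / M.r s
      = (((n : ℝ) - 2) * (1 - deriv M.r s ^ 2) - 2 * M.r s * deriv (deriv M.r) s)
        / M.r s ^ 2 := by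
    field_simp
  rw [e] at h2
  have h3 := mul_nonneg h2 (sq_nonneg (M.r s))
  rw [div_mul_cancel₀ _ (by positivity)] at h3
  linarith

/-- The derivative is `½ rⁿ⁻³ r' ((n - 2)(1 - r'²) - 2 r r'')`, a product of nonnegative factors.
The endpoint 0 is left out since `deriv M.r 0` involves values of `r` at negative arguments, which
are arbitrary. -/
theorem hawkingMass_monotoneOn (hn : 3 ≤ n) : MonotoneOn M.hawkingMass (Ioi 0) := by
  have hd : ∀ s, 0 < s → HasDerivAt M.hawkingMass
      (((n - 2 : ℕ) * M.r s ^ (n - 2 - 1) * deriv M.r s) / 2 * (1 - deriv M.r s ^ 2)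
        + M.r s ^ (n - 2) / 2 * (-(2 * deriv M.r s * deriv (deriv M.r) s))) s := fun s hs => by
    refine ((((M.hasDerivAt_r hs).fun_pow (n - 2)).div_const 2).fun_mul
      (((M.hasDerivAt_deriv_r hs).fun_pow 2).const_sub 1)).congr_deriv ?_
    norm_num
  refine monotoneOn_of_deriv_nonneg (convex_Ioi 0)
    (fun s hs => (hd s hs).continuousAt.continuousWithinAt)
    (fun s hs => ?_) (fun s hs => ?_)
  · rw [interior_Ioi] at *
    exact (hd s hs).differentiableAt.differentiableWithinAt
  · rw [interior_Ioi] at hs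
    rw [(hd s hs).deriv]
    have h1 := M.two_mul_deriv_deriv_r_le hn hs
    have h2 := M.deriv_r_pos hn hs
    have h3 := M.pos s (le_of_lt hs)
    obtain ⟨k, rfl⟩ : ∃ k, n = k + 3 := ⟨n - 3, by omega⟩
    rw [show k + 3 - 2 - 1 = k by omega, show k + 3 - 2 = k + 1 by omega, pow_succ (M.r s) k]
    push_cast at h1 ⊢
    have h4 : 0 ≤ M.r s ^ k * deriv M.r s / 2
        * (((k : ℝ) + 3 - 2) * (1 - deriv M.r s ^ 2) - 2 * M.r s * deriv (deriv M.r) s) :=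
      mul_nonneg (by positivity) (by linarith)
    nlinarith

theorem two_mul_boundaryMass (hn : 3 ≤ n) : 2 * M.boundaryMass = M.r 0 ^ (n - 2) := by
  have h0 := M.pos 0 le_rfl
  have hω := unitSphereArea_pos (by omega : 0 < n)
  have hn1 : ((n : ℝ) - 1) ≠ 0 := by
    have : (3 : ℝ) ≤ n := by exact_mod_cast hn
    linarith
  simp only [boundaryMass, boundaryArea, space, WarpedCylinder.sphereArea]
  rw [mul_div_cancel_left₀ _ hω.ne', ← Real.rpow_natCast, ← Real.rpow_mul h0.le,
    Nat.cast_sub (by omega), Nat.cast_one, mul_div_cancel₀ _ hn1, ← natCast_sub_two hn,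
    Real.rpow_natCast]
  ring

theorem boundaryMass_pos (hn : 3 ≤ n) : 0 < M.boundaryMass := by
  have := M.two_mul_boundaryMass hn
  have := pow_pos (M.pos 0 le_rfl) (n - 2)
  linarith

theorem horizonRadius_boundaryMass (hn : 3 ≤ n) :
    horizonRadius n M.boundaryMass = M.r 0 := by
  rw [horizonRadius, M.two_mul_boundaryMass hn, ← natCast_sub_two hn]
  exact Real.pow_rpow_inv_natCast (M.pos 0 le_rfl).le (by omega)

theorem boundaryMass_le_hawkingMass (hn : 3 ≤ n) {s : ℝ} (hs : 0 < s) :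
    M.boundaryMass ≤ M.hawkingMass s := by
  have h1 : Tendsto M.r (𝓝[>] 0) (𝓝 (M.r 0)) :=
    (M.smooth.continuousOn 0 self_mem_Ici).mono_left (nhdsWithin_mono _ Ioi_subset_Ici_self)
  -- Minimality of the boundary enters here, through the one-sided derivative, which is continuous
  -- up to 0 and vanishes there.
  have h2 : Tendsto (deriv M.r) (𝓝[>] 0) (𝓝 0) := by
    have h := (M.smooth.continuousOn_derivWithin (uniqueDiffOn_Ici 0) (by simp))
      0 self_mem_Ici |>.mono_left (nhdsWithin_mono _ Ioi_subset_Ici_self)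
    rw [M.derivWithin_r_zero hn] at h
    exact h.congr' (eventually_nhdsWithin_of_forall fun t ht => M.derivWithin_r ht)
  have h3 : Tendsto M.hawkingMass (𝓝[>] 0) (𝓝 (M.r 0 ^ (n - 2) / 2 * (1 - 0 ^ 2))) :=
    ((h1.pow (n - 2)).div_const 2).mul ((h2.pow 2).const_sub 1)
  have h4 := le_of_tendsto h3 (b := M.hawkingMass s) (by
    filter_upwards [Ioo_mem_nhdsGT hs] with t ht
    exact M.hawkingMass_monotoneOn hn ht.1 hs ht.2.le)
  have := M.two_mul_boundaryMass hn
  linarith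

theorem hawkingMass_le (hn : 3 ≤ n) {m : ℝ} (hm : M.HasADMMass m) {s : ℝ} (hs : 0 < s) :
    M.hawkingMass s ≤ m :=
  ge_of_tendsto hm (by
    filter_upwards [eventually_ge_atTop s] with t ht
    exact M.hawkingMass_monotoneOn hn hs (hs.trans_le ht) ht)

theorem deriv_r_sq_le (hn : 3 ≤ n) {s : ℝ} (hs : 0 < s) :
    deriv M.r s ^ 2 ≤ 1 - 2 * M.boundaryMass / M.r s ^ (n - 2) := by
  have h := M.boundaryMass_le_hawkingMass hn hs
  have h1 := pow_pos (M.pos s hs.le) (n - 2)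
  rw [hawkingMass] at h
  rw [le_sub_comm, div_le_iff₀ h1]
  linarith

theorem le_deriv_r_sq (hn : 3 ≤ n) {m : ℝ} (hm : M.HasADMMass m) {s : ℝ} (hs : 0 < s) :
    1 - 2 * m / M.r s ^ (n - 2) ≤ deriv M.r s ^ 2 := by
  have h := M.hawkingMass_le hn hm hs
  have h1 := pow_pos (M.pos s hs.le) (n - 2)
  rw [hawkingMass] at h
  rw [sub_le_comm, le_div_iff₀ h1]
  linarith

theorem r_zero_lt (hn : 3 ≤ n) {s : ℝ} (hs : 0 < s) : M.r 0 < M.r s :=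
  M.strictMonoOn_r hn self_mem_Ici hs.le hs

theorem deriv_r_lt_one (hn : 3 ≤ n) {s : ℝ} (hs : 0 < s) : deriv M.r s < 1 := by
  have h1 := M.deriv_r_sq_le hn hs
  have h2 := schwarzschild_lapse_lt_one (n := n) (M.boundaryMass_pos hn) (M.pos s hs.le)
  have h3 := M.deriv_r_pos hn hs
  nlinarith

theorem space_isTame (hn : 3 ≤ n) : M.space.IsTame (M.r 0) where
  pos := M.pos 0 le_rfl
  le_radius s hs := (M.strictMonoOn_r hn).monotoneOn self_mem_Ici hs hs
  mono u v hu huv := (M.strictMonoOn_r hn).monotoneOn hu (hu.trans huv) huv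
  radius_le u v hu huv := by
    have h : AntitoneOn (fun s => M.r s - s) (Ici 0) := by
      refine antitoneOn_of_hasDerivWithinAt_nonpos (convex_Ici 0)
        (M.smooth.continuousOn.sub continuousOn_id) (f' := fun s => deriv M.r s - 1)
        (fun s hs => ?_) (fun s hs => ?_)
      · rw [interior_Ici] at hs
        exact ((M.hasDerivAt_r hs).sub (hasDerivAt_id s)).hasDerivWithinAt
      · rw [interior_Ici] at hs
        linarith [M.deriv_r_lt_one hn hs]
    have := h hu (hu.trans huv) huv
    simp only [space] at *
    linarith

end RotSymBdry

/-! ### Comparison with Schwarzschild space -/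

namespace RotSymBdry

variable {n : ℕ} (M : RotSymBdry n)

theorem horizonRadius_lt_r (hn : 3 ≤ n) {s : ℝ} (hs : 0 < s) :
    horizonRadius n M.boundaryMass < M.r s := by
  rw [M.horizonRadius_boundaryMass hn]; exact M.r_zero_lt hn hs

theorem horizonRadius_le_r (hn : 3 ≤ n) {s : ℝ} (hs : 0 ≤ s) :
    horizonRadius n M.boundaryMass ≤ M.r s := by
  rw [M.horizonRadius_boundaryMass hn]
  exact (M.strictMonoOn_r hn).monotoneOn self_mem_Ici hs hs

theorem continuousOn_arclength_r (hn : 3 ≤ n) :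
    ContinuousOn (fun s => schwarzschildArclength n M.boundaryMass (M.r s)) (Ici 0) :=
  (continuousOn_schwarzschildArclength hn (M.boundaryMass_pos hn)).comp M.smooth.continuousOn
    fun _ hs => M.horizonRadius_le_r hn hs

theorem hasDerivAt_arclength_r (hn : 3 ≤ n) {s : ℝ} (hs : 0 < s) :
    HasDerivAt (fun s => schwarzschildArclength n M.boundaryMass (M.r s))
      ((√(1 - 2 * M.boundaryMass / M.r s ^ (n - 2)))⁻¹ * deriv M.r s) s :=
  (hasDerivAt_schwarzschildArclength hn (M.boundaryMass_pos hn)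
    (M.horizonRadius_lt_r hn hs)).comp s (M.hasDerivAt_r hs)

/-- The slope of `A ∘ r` is `r' / √(1 - 2m₀ / rⁿ⁻²)`, at most 1 because the Hawking mass is at least
`m₀`. -/
theorem arclength_r_sub_le (hn : 3 ≤ n) {u v : ℝ} (hu : 0 ≤ u) (huv : u ≤ v) :
    schwarzschildArclength n M.boundaryMass (M.r v)
      - schwarzschildArclength n M.boundaryMass (M.r u) ≤ v - u := by
  have h : MonotoneOn (fun s => s - schwarzschildArclength n M.boundaryMass (M.r s))
      (Ici 0) := by
    refine monotoneOn_of_hasDerivWithinAt_nonneg (convex_Ici 0)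
      (continuousOn_id.sub (M.continuousOn_arclength_r hn))
      (fun s hs => ?_) (fun s hs => ?_)
      (f' := fun s => 1 - (√(1 - 2 * M.boundaryMass / M.r s ^ (n - 2)))⁻¹ * deriv M.r s)
    · rw [interior_Ici] at hs
      exact ((hasDerivAt_id s).sub (M.hasDerivAt_arclength_r hn hs)).hasDerivWithinAt
    · rw [interior_Ici] at hs
      have h1 := schwarzschild_lapse_pos hn (M.boundaryMass_pos hn) (M.horizonRadius_lt_r hn hs)
      rw [sub_nonneg, inv_mul_le_one₀ (Real.sqrt_pos.2 h1)]
      exact Real.le_sqrt_of_sq_le (M.deriv_r_sq_le hn hs)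
  have := h hu (hu.trans huv) huv
  simp only at this
  linarith

/-- With `R = rⁿ⁻²`, the difference of `1 - 2m / R` and `(1 - e)(1 - 2m₀ / R)` is `e (R - 2(1 + e)
m₀) / R`. It is nonnegative exactly from the matching radius on if `e > 0`, which explains the
choice of `r_δ`. -/
theorem le_arclength_r_sub (hn : 3 ≤ n) {m e : ℝ} (hm : M.HasADMMass m) (he : 0 ≤ e)
    (hme : m = (1 + e ^ 2) * M.boundaryMass) {u v : ℝ} (hu : 0 ≤ u) (huv : u ≤ v)
    (hR : (1 + e) * (2 * M.boundaryMass) ≤ M.r u ^ (n - 2)) :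
    √(1 - e) * (v - u) ≤ schwarzschildArclength n M.boundaryMass (M.r v)
      - schwarzschildArclength n M.boundaryMass (M.r u) := by
  have h : MonotoneOn (fun s => schwarzschildArclength n M.boundaryMass (M.r s) - √(1 - e) * s)
      (Ici u) := by
    refine monotoneOn_of_hasDerivWithinAt_nonneg (convex_Ici u)
      (((M.continuousOn_arclength_r hn).mono (Ici_subset_Ici.2 hu)).sub (by fun_prop))
      (fun s hs => ?_) (fun s hs => ?_)
      (f' := fun s => (√(1 - 2 * M.boundaryMass / M.r s ^ (n - 2)))⁻¹ * deriv M.r s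
        - √(1 - e) * 1)
    · rw [interior_Ici] at hs
      exact ((M.hasDerivAt_arclength_r hn (lt_of_le_of_lt hu hs)).sub
        ((hasDerivAt_id s).const_mul _)).hasDerivWithinAt
    · rw [interior_Ici] at hs
      have hs0 : 0 < s := lt_of_le_of_lt hu hs
      have h1 := schwarzschild_lapse_pos hn (M.boundaryMass_pos hn) (M.horizonRadius_lt_r hn hs0)
      have h2 := M.le_deriv_r_sq hn hm hs0
      have h3 := pow_pos (M.pos s hs0.le) (n - 2)
      have h4 : (1 + e) * (2 * M.boundaryMass) ≤ M.r s ^ (n - 2) :=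
        hR.trans (pow_le_pow_left₀ (M.pos u hu).le
          ((M.strictMonoOn_r hn).monotoneOn hu hs0.le (le_of_lt hs)) _)
      have h5 : (1 - e) * (1 - 2 * M.boundaryMass / M.r s ^ (n - 2))
          ≤ 1 - 2 * m / M.r s ^ (n - 2) := by
        have e1 : 1 - 2 * m / M.r s ^ (n - 2)
            - (1 - e) * (1 - 2 * M.boundaryMass / M.r s ^ (n - 2))
            = e * (M.r s ^ (n - 2) - (1 + e) * (2 * M.boundaryMass)) / M.r s ^ (n - 2) := by
          rw [hme]; field_simp; ring
        have : 0 ≤ e * (M.r s ^ (n - 2) - (1 + e) * (2 * M.boundaryMass)) / M.r s ^ (n - 2) :=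
          div_nonneg (mul_nonneg he (sub_nonneg.2 h4)) h3.le
        linarith
      rw [mul_one, sub_nonneg, inv_mul_eq_div, le_div_iff₀ (Real.sqrt_pos.2 h1),
        ← Real.sqrt_mul' _ h1.le]
      exact (Real.sqrt_le_left (M.deriv_r_pos hn hs0).le).2 (h5.trans h2)
  have := h (self_mem_Ici) huv huv
  simp only at this
  linarith

theorem intervalIntegrable_rise (b : ℝ) :
    IntervalIntegrable (fun t => √(1 - deriv M.r t ^ 2)) volume 0 b := by
  refine (intervalIntegrable_const (c := (1 : ℝ))).mono_fun
    (Measurable.aestronglyMeasurable ?_) (ae_of_all _ fun t => ?_)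
  · exact ((measurable_deriv M.r).pow_const 2).const_sub 1 |>.sqrt
  · simp only [norm_one, Real.norm_of_nonneg (Real.sqrt_nonneg _)]
    exact Real.sqrt_le_one.2 (by linarith [sq_nonneg (deriv M.r t)])

theorem continuousOn_rise : ContinuousOn M.rise (Ici 0) :=
  continuousOn_primitive_Ici fun b _ => M.intervalIntegrable_rise b

theorem hasDerivAt_rise {s : ℝ} (hs : 0 < s) :
    HasDerivAt M.rise (√(1 - deriv M.r s ^ 2)) s :=
  hasDerivAt_primitive_Ioi (fun b _ => M.intervalIntegrable_rise b)
    (continuousOn_const.sub (M.contDiffOn_deriv_r.continuousOn.pow 2)).sqrt hs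

theorem rise_zero : M.rise 0 = 0 := intervalIntegral.integral_same

theorem rise_le {s : ℝ} (hs : 0 ≤ s) : M.rise s ≤ s := by
  have h : MonotoneOn (fun s => s - M.rise s) (Ici 0) := by
    refine monotoneOn_of_hasDerivWithinAt_nonneg (convex_Ici 0)
      (continuousOn_id.sub M.continuousOn_rise) (f' := fun s => 1 - √(1 - deriv M.r s ^ 2))
      (fun s hs => ?_) (fun s hs => ?_)
    · rw [interior_Ici] at hs
      exact ((hasDerivAt_id s).sub (M.hasDerivAt_rise hs)).hasDerivWithinAt
    · exact sub_nonneg.2 (Real.sqrt_le_one.2 (by linarith [sq_nonneg (deriv M.r s)]))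
  have := h self_mem_Ici hs hs
  simp only [rise_zero] at this
  linarith

/-- `1 - √(1 - x²) ≤ x` for `0 ≤ x ≤ 1`, applied to `x = r'`: arclength exceeds height by at most
the gain in radius, however long the neck is. -/
theorem sub_rise_le (hn : 3 ≤ n) {s : ℝ} (hs : 0 ≤ s) : s - M.rise s ≤ M.r s - M.r 0 := by
  have h : MonotoneOn (fun s => M.r s - (s - M.rise s)) (Ici 0) := by
    refine monotoneOn_of_hasDerivWithinAt_nonneg (convex_Ici 0)
      (M.smooth.continuousOn.sub (continuousOn_id.sub M.continuousOn_rise))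
      (f' := fun s => deriv M.r s - (1 - √(1 - deriv M.r s ^ 2)))
      (fun s hs => ?_) (fun s hs => ?_)
    · rw [interior_Ici] at hs
      exact ((M.hasDerivAt_r hs).sub
        ((hasDerivAt_id s).sub (M.hasDerivAt_rise hs))).hasDerivWithinAt
    · rw [interior_Ici] at hs
      have h1 := M.deriv_r_pos hn hs
      have h2 := M.deriv_r_lt_one hn hs
      have h3 : 1 - deriv M.r s ≤ √(1 - deriv M.r s ^ 2) :=
        Real.le_sqrt_of_sq_le (by nlinarith)
      linarith
  have := h self_mem_Ici hs hs
  simp only [rise_zero] at this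
  linarith

/-- At equal radius the graph of `M` is at least as steep as the Schwarzschild graph, since `r'` is
at most its Schwarzschild value. Hence the depth is nonnegative. -/
theorem schwarzschildHeight_r_le_rise (hn : 3 ≤ n) {s : ℝ} (hs : 0 ≤ s) :
    schwarzschildHeight n M.boundaryMass (M.r s) ≤ M.rise s := by
  have hm := M.boundaryMass_pos hn
  have h : MonotoneOn (fun s => M.rise s - schwarzschildHeight n M.boundaryMass (M.r s))
      (Ici 0) := by
    refine monotoneOn_of_hasDerivWithinAt_nonneg (convex_Ici 0)
      (M.continuousOn_rise.sub ((continuousOn_schwarzschildHeight hn hm).comp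
        M.smooth.continuousOn fun _ hs => M.horizonRadius_le_r hn hs))
      (f' := fun s => √(1 - deriv M.r s ^ 2)
        - √(2 * M.boundaryMass / (M.r s ^ (n - 2) - 2 * M.boundaryMass)) * deriv M.r s)
      (fun s hs => ?_) (fun s hs => ?_)
    · rw [interior_Ici] at hs
      exact ((M.hasDerivAt_rise hs).sub ((hasDerivAt_schwarzschildHeight hn hm
        (M.horizonRadius_lt_r hn hs)).comp s (M.hasDerivAt_r hs))).hasDerivWithinAt
    · rw [interior_Ici] at hs
      have h1 := M.deriv_r_pos hn hs
      have h2 := M.deriv_r_sq_le hn hs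
      have h3 := lt_pow_of_horizonRadius_lt hn hm (M.horizonRadius_lt_r hn hs)
      have h4 : 0 < M.r s ^ (n - 2) - 2 * M.boundaryMass := sub_pos.2 h3
      have h5 := pow_pos (M.pos s (le_of_lt hs)) (n - 2)
      rw [sub_nonneg]
      refine Real.le_sqrt_of_sq_le ?_
      rw [mul_pow, Real.sq_sqrt (by positivity)]
      have h6 : 2 * M.boundaryMass / (M.r s ^ (n - 2) - 2 * M.boundaryMass) * deriv M.r s ^ 2
          ≤ 2 * M.boundaryMass / (M.r s ^ (n - 2) - 2 * M.boundaryMass)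
            * (1 - 2 * M.boundaryMass / M.r s ^ (n - 2)) :=
        mul_le_mul_of_nonneg_left h2 (by positivity)
      have h7 : 2 * M.boundaryMass / (M.r s ^ (n - 2) - 2 * M.boundaryMass)
            * (1 - 2 * M.boundaryMass / M.r s ^ (n - 2))
          = 2 * M.boundaryMass / M.r s ^ (n - 2) := by
        field_simp
      linarith
  have := h self_mem_Ici hs hs
  have e : schwarzschildHeight n M.boundaryMass (M.r 0) = 0 := by
    rw [← M.horizonRadius_boundaryMass hn]; exact intervalIntegral.integral_same
  simp only [rise_zero, e] at this
  linarith

/-- Since `r(0) ≤ r_δ < r(s₁)`, the radius `r_δ` is attained, so the inverse function in the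
definition of the depth takes a genuine value, below `s₁`. -/
theorem exists_matching (hn : 3 ≤ n) {m s₁ : ℝ} (hs₁ : 0 ≤ s₁)
    (hlt : M.matchingRadius m < M.r s₁) :
    ∃ s, 0 ≤ s ∧ s < s₁ ∧ M.r s = M.matchingRadius m ∧
      M.depth m = M.rise s - schwarzschildHeight n M.boundaryMass (M.r s) := by
  have h0 := M.pos 0 le_rfl
  have hle : M.r 0 ≤ M.matchingRadius m := by
    rw [matchingRadius]
    refine le_mul_of_one_le_left h0.le (Real.one_le_rpow ?_ ?_)
    · linarith [Real.sqrt_nonneg (m / M.boundaryMass - 1)]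
    · rw [← natCast_sub_two hn]; positivity
  obtain ⟨s, hs, he⟩ := intermediate_value_Icc hs₁ (M.smooth.continuousOn.mono Icc_subset_Ici_self)
    ⟨hle, hlt.le⟩
  have hex : ∃ s ∈ Ici (0 : ℝ), M.r s = M.matchingRadius m := ⟨s, hs.1, he⟩
  have h1 := Function.invFunOn_mem hex
  have h2 := Function.invFunOn_eq hex
  refine ⟨_, h1, ?_, h2, by rw [h2, depth]⟩
  rw [← h2] at hlt
  exact (M.strictMonoOn_r hn).lt_iff_lt h1 hs₁ |>.1 hlt

theorem matchingRadius_pow (hn : 3 ≤ n) (m : ℝ) : M.matchingRadius m ^ (n - 2)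
    = (1 + √(m / M.boundaryMass - 1)) * (2 * M.boundaryMass) := by
  rw [matchingRadius, mul_pow, rpow_inv_pow_sub_two hn (by positivity), M.two_mul_boundaryMass hn]

/-- The tubes around the spheres of radius `r(s₁)` in `M` and in the appended Schwarzschild space
are close if the ADM mass is close to the boundary mass. -/
theorem areClose (hn : 3 ≤ n) {m s₁ D : ℝ} (hm : M.HasADMMass m) (hs₁ : 0 ≤ s₁) (hD : 0 < D)
    (hlt : M.matchingRadius m < M.r s₁) (hhalf : 1 / 2 ≤ √(1 - √(m / M.boundaryMass - 1))) :
    M.space.AreClose (appendedSchwarzschild n M.boundaryMass (M.depth m)) s₁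
      (schwarzschildArclength n M.boundaryMass (M.r s₁)) D s₁
      (schwarzschildArclength n M.boundaryMass (M.r s₁) + M.depth m)
      ((1 - √(1 - √(m / M.boundaryMass - 1)))
          * (D + 2 * schwarzschildArclength n M.boundaryMass (M.r s₁))
        + schwarzschildArclength n M.boundaryMass (M.matchingRadius m))
      (2 * ((1 - √(1 - √(m / M.boundaryMass - 1)))
          * (D + 2 * schwarzschildArclength n M.boundaryMass (M.r s₁))
        + schwarzschildArclength n M.boundaryMass (M.matchingRadius m))) := by
  obtain ⟨σ, hσ0, hσ1, hσ, hdepth⟩ := M.exists_matching hn hs₁ hlt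
  have hm0 := M.boundaryMass_pos hn
  have hmm : M.boundaryMass ≤ m :=
    (M.boundaryMass_le_hawkingMass hn one_pos).trans (M.hawkingMass_le hn hm one_pos)
  set e := √(m / M.boundaryMass - 1) with he
  have he0 : 0 ≤ e := Real.sqrt_nonneg _
  have hme : m = (1 + e ^ 2) * M.boundaryMass := by
    rw [he, Real.sq_sqrt (sub_nonneg.2 ((one_le_div hm0).2 hmm))]
    field_simp
    ring
  have hpow := M.matchingRadius_pow hn m
  rw [← he, ← hσ] at hpow
  rw [← hσ]
  set q := √(1 - e) with hq
  have hq1 : q ≤ 1 := Real.sqrt_le_one.2 (by linarith)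
  set A := schwarzschildArclength n M.boundaryMass with hA
  set L := M.depth m with hL
  have up : ∀ u v, 0 ≤ u → u ≤ v → A (M.r v) - A (M.r u) ≤ v - u := fun u v hu huv =>
    M.arclength_r_sub_le hn hu huv
  have low : ∀ u v, σ ≤ u → u ≤ v → q * (v - u) ≤ A (M.r v) - A (M.r u) := fun u v hu huv =>
    M.le_arclength_r_sub hn hm he0 hme (hσ0.trans hu) huv
      (hpow.symm.le.trans (pow_le_pow_left₀ (M.pos σ hσ0).le
        ((M.strictMonoOn_r hn).monotoneOn hσ0 (hσ0.trans hu) hu) _))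
  have Anonneg : ∀ s, 0 ≤ s → M.r s - M.r 0 ≤ A (M.r s) := fun s hs => by
    have := sub_le_schwarzschildArclength hn hm0 (M.horizonRadius_le_r hn hs)
    rwa [M.horizonRadius_boundaryMass hn] at this
  have rnonneg : ∀ s, 0 ≤ s → M.r 0 ≤ M.r s := fun s hs =>
    (M.strictMonoOn_r hn).monotoneOn self_mem_Ici hs hs
  have hL0 : 0 ≤ L := by
    rw [hdepth]; linarith [M.schwarzschildHeight_r_le_rise hn hσ0]
  have hLσ : L ≤ σ := by
    have h1 := M.rise_le hσ0
    have h2 : 0 ≤ schwarzschildHeight n M.boundaryMass (M.r σ) :=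
      intervalIntegral.integral_nonneg (M.horizonRadius_le_r hn hσ0) fun t _ =>
        Real.sqrt_nonneg _
    rw [hdepth]; linarith
  -- One `A(r_δ)` bounds arclength minus rise in `M`, the other the Schwarzschild height.
  have hσL : σ - L ≤ 2 * A (M.r σ) := by
    have h1 := M.sub_rise_le hn hσ0
    have h2 := schwarzschildHeight_le_arclength hn hm0 (M.horizonRadius_le_r hn hσ0)
    have h3 := Anonneg σ hσ0
    rw [hdepth]; linarith
  have hA1 : 0 ≤ A (M.r s₁) := by linarith [Anonneg s₁ hs₁, rnonneg s₁ hs₁]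
  have hAσ : 0 ≤ A (M.r σ) := by linarith [Anonneg σ hσ0, rnonneg σ hσ0]
  -- Slope at least `1/2` bounds the length of the part between the matching sphere and `s₁` in
  -- terms of `r(s₁)` alone; an arbitrarily long neck lies inside the matching sphere.
  have hlow1 : ∀ u, σ ≤ u → u ≤ s₁ → s₁ - u ≤ 2 * A (M.r s₁) := fun u hu hu1 => by
    have h1 := low u s₁ hu hu1
    have h2 : 0 ≤ A (M.r u) := by
      linarith [Anonneg u (hσ0.trans hu), rnonneg u (hσ0.trans hu)]
    have h3 : 1 / 2 * (s₁ - u) ≤ q * (s₁ - u) :=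
      mul_le_mul_of_nonneg_right hhalf (by linarith)
    linarith
  set κ := (1 - q) * (D + 2 * A (M.r s₁)) + A (M.r σ) with hκ
  have hq2 : ∀ x, x ≤ D + 2 * A (M.r s₁) → (1 - q) * x ≤ κ - A (M.r σ) := fun x hx => by
    have := mul_le_mul_of_nonneg_left hx (sub_nonneg.2 hq1)
    linarith
  have hradius : ∀ t ∈ Icc (-s₁) D,
      |M.r (s₁ + t) - (appendedSchwarzschild n M.boundaryMass L).radius (A (M.r s₁) + t)|
        ≤ κ := by
    intro t ht
    have hst : 0 ≤ s₁ + t := by linarith [ht.1]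
    -- Outside the matching sphere the positions `A(r(s₁ + t))` and `A(r(s₁)) + t` are compared.
    -- Inside it both radii lie in `[r(0), r_δ]`, an interval of length at most `A(r_δ)`.
    rcases le_total σ (s₁ + t) with h | h
    · have e1 := abs_appendedSchwarzschild_radius_sub_le hn hm0 L (A (M.r (s₁ + t)))
        (A (M.r s₁) + t)
      rw [appendedSchwarzschild_radius_arclength hn hm0 L (M.horizonRadius_le_r hn hst)] at e1
      refine e1.trans ?_
      rcases le_total 0 t with h0 | h0
      · have h1 := up s₁ (s₁ + t) hs₁ (by linarith)
        have h2 := low s₁ (s₁ + t) hσ1.le (by linarith)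
        have h3 := hq2 t (by linarith [ht.2])
        rw [abs_le]
        constructor <;> linarith
      · have h1 := up (s₁ + t) s₁ hst (by linarith)
        have h2 := low (s₁ + t) s₁ h (by linarith)
        have h3 := hq2 (-t) (by linarith [hlow1 (s₁ + t) h (by linarith)])
        rw [abs_le]
        constructor <;> linarith
    · have h1 := up (s₁ + t) s₁ hst (by linarith)
      have h2 := (M.strictMonoOn_r hn).monotoneOn hst hσ0 h
      have h3 : A (M.r (s₁ + t)) ≤ A (M.r σ) :=
        (schwarzschildArclength_strictMonoOn hn hm0).monotoneOn
          (M.horizonRadius_le_r hn hst) (M.horizonRadius_le_r hn hσ0) h2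
      have h4 := (appendedSchwarzschild_radius_spec hn hm0 L (A (M.r s₁) + t)).1
      rw [M.horizonRadius_boundaryMass hn] at h4
      have h5 := appendedSchwarzschild_radius_mono hn hm0 L
        (show A (M.r s₁) + t ≤ A (M.r σ) by linarith)
      rw [appendedSchwarzschild_radius_arclength hn hm0 L (M.horizonRadius_le_r hn hσ0)] at h5
      have h6 := rnonneg _ hst
      have h7 := Anonneg σ hσ0
      have h8 := hq2 0 (by positivity)
      rw [abs_le]
      constructor <;> linarith
  refine ⟨by simp [space], by simp [appendedSchwarzschild], hs₁, by linarith, ?_, ?_⟩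
  -- The difference is `(s₁ - σ) - (A(r(s₁)) - A(r_δ))`, between 0 and `(1 - q)(s₁ - σ)`, plus `σ -
  -- L - A(r_δ)`, of absolute value at most `A(r_δ)`.
  · have h1 := up σ s₁ hσ0 hσ1.le
    have h2 := low σ s₁ le_rfl hσ1.le
    have h3 := hq2 (s₁ - σ) (by linarith [hlow1 σ le_rfl hσ1.le])
    have h4 := hq2 0 (by positivity)
    rw [abs_le]
    constructor <;> linarith
  -- One `κ` comes from comparing radii at the same `t`, the other from moving `t` to `t'` in the
  -- 1-Lipschitz Schwarzschild radius; hence `η = 2κ`.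
  · intro t ht t' _ htt
    have h1 := hradius t ht
    have h2 := abs_appendedSchwarzschild_radius_sub_le hn hm0 L (A (M.r s₁) + t)
      (A (M.r s₁) + t')
    rw [add_sub_add_left_eq_sub] at h2
    have h3 := abs_sub_le (M.r (s₁ + t))
      ((appendedSchwarzschild n M.boundaryMass L).radius (A (M.r s₁) + t))
      ((appendedSchwarzschild n M.boundaryMass L).radius (A (M.r s₁) + t'))
    have e1 : M.space.radius (s₁ + t) = M.r (s₁ + t) := rfl
    rw [e1]
    linarith

end RotSymBdry

/-! ### Uniform choice of `δ` and conclusion -/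

namespace WarpedCylinder

theorem symmetricSphere_eq_strip {n : ℕ} {N : WarpedCylinder} {A a : ℝ} (ha : N.start ≤ a)
    (h : ∀ s, N.start ≤ s → (N.sphereArea n s = A ↔ s = a)) :
    N.symmetricSphere n A = strip n {a} := by
  ext ⟨s, θ⟩
  constructor
  · rintro ⟨⟨h1, h2⟩, h3⟩
    exact ⟨(h s h1).1 h3, h2⟩
  · rintro ⟨h1, h2⟩
    have h3 : s = a := h1
    subst h3
    exact ⟨⟨ha, h2⟩, (h s ha).2 rfl⟩

end WarpedCylinder

theorem tendsto_matchingRadius {n : ℕ} (m : ℝ) :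
    Tendsto (fun d : ℝ => (1 + √d) ^ (((n : ℝ) - 2)⁻¹) * horizonRadius n m) (𝓝[≥] 0)
      (𝓝 (horizonRadius n m)) := by
  have hc : ContinuousAt (fun d : ℝ => (1 + √d) ^ (((n : ℝ) - 2)⁻¹) * horizonRadius n m) 0 := by
    refine ContinuousAt.mul (ContinuousAt.rpow_const (by fun_prop) (Or.inl ?_)) continuousAt_const
    simp
  have := hc.tendsto.mono_left (nhdsWithin_le_nhds (s := Ici 0))
  simpa using this

theorem tendsto_schwarzschildArclength_matchingRadius {n : ℕ} (hn : 3 ≤ n) {m : ℝ}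
    (hm : 0 < m) :
    Tendsto (fun d : ℝ => schwarzschildArclength n m
      ((1 + √d) ^ (((n : ℝ) - 2)⁻¹) * horizonRadius n m)) (𝓝[≥] 0) (𝓝 0) := by
  have h0 := horizonRadius_pos (n := n) hm
  have h1 : Tendsto (fun d : ℝ => (1 + √d) ^ (((n : ℝ) - 2)⁻¹) * horizonRadius n m) (𝓝[≥] 0)
      (𝓝[≥] (horizonRadius n m)) := by
    refine tendsto_nhdsWithin_iff.2 ⟨tendsto_matchingRadius m, Eventually.of_forall fun d => ?_⟩
    refine le_mul_of_one_le_left h0.le (Real.one_le_rpow (by linarith [Real.sqrt_nonneg d]) ?_)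
    rw [← natCast_sub_two hn]; positivity
  have h2 := (continuousOn_schwarzschildArclength hn hm) _ (self_mem_Ici)
  have h3 := h2.tendsto.comp h1
  rwa [schwarzschildArclength_horizonRadius] at h3

end

theorem mainTheorem4 (n : ℕ) (hn : 3 ≤ n) (A₀ A₁ : ℝ) (hA₀ : 0 < A₀) (hA₁ : A₀ < A₁)
    (D : ℝ) (hD : 0 < D) (ε : ℝ) (hε : 0 < ε) :
    ∃ δ : ℝ, 0 < δ ∧ ∀ (M : RotSymBdry n) (m : ℝ),
      M.boundaryArea = A₀ → M.HasADMMass m →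
      m < (1 + δ) / 2 * (A₀ / unitSphereArea n) ^ (((n : ℝ) - 2) / ((n : ℝ) - 1)) →
      (M.space.symmetricSphere n A₁).Nonempty →
      WarpedCylinder.restrictedLipDist M.space
          (appendedSchwarzschild n M.boundaryMass (M.depth m))
          (M.space.tube D (M.space.symmetricSphere n A₁))
          ((appendedSchwarzschild n M.boundaryMass (M.depth m)).tube D
            ((appendedSchwarzschild n M.boundaryMass (M.depth m)).symmetricSphere n A₁))
          < ENNReal.ofReal ε ∧
        WarpedCylinder.intrinsicLipDist M.space
          (appendedSchwarzschild n M.boundaryMass (M.depth m))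
          (M.space.tube D (M.space.symmetricSphere n A₁))
          ((appendedSchwarzschild n M.boundaryMass (M.depth m)).tube D
            ((appendedSchwarzschild n M.boundaryMass (M.depth m)).symmetricSphere n A₁))
          < ENNReal.ofReal ε := by
  have hω := unitSphereArea_pos (by omega : 0 < n)
  set m₀ : ℝ := 1 / 2 * (A₀ / unitSphereArea n) ^ (((n : ℝ) - 2) / ((n : ℝ) - 1)) with hm₀
  have hm₀pos : 0 < m₀ := by positivity
  set r₀ := horizonRadius n m₀ with hr₀
  have hr₀pos : 0 < r₀ := horizonRadius_pos hm₀pos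
  have hn1 : ((n - 1 : ℕ) : ℝ) = (n : ℝ) - 1 := by rw [Nat.cast_sub (by omega), Nat.cast_one]
  have hn2 := natCast_sub_two hn
  have hn0 : n - 1 ≠ 0 := by omega
  have hr₀pow : r₀ ^ (n - 1) = A₀ / unitSphereArea n := by
    have hx : 0 ≤ A₀ / unitSphereArea n := by positivity
    have hne1 : ((n - 1 : ℕ) : ℝ) ≠ 0 := by norm_cast
    have hne2 : ((n - 2 : ℕ) : ℝ) ≠ 0 := by norm_cast; omega
    rw [hr₀, horizonRadius, hm₀, ← mul_assoc, mul_one_div_cancel two_ne_zero, one_mul, ← Real.rpow_mul hx,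
      ← Real.rpow_natCast, ← Real.rpow_mul hx, ← hn1, ← hn2]
    rw [show ((n - 2 : ℕ) : ℝ) / ((n - 1 : ℕ) : ℝ) * ((n - 2 : ℕ) : ℝ)⁻¹ * ((n - 1 : ℕ) : ℝ) = 1
      by field_simp, Real.rpow_one]
  set r₁ : ℝ := (A₁ / unitSphereArea n) ^ (((n - 1 : ℕ) : ℝ)⁻¹) with hr₁
  have hr₁nonneg : 0 ≤ r₁ := Real.rpow_nonneg (div_nonneg (hA₀.trans hA₁).le hω.le) _
  have hr₁pow : r₁ ^ (n - 1) = A₁ / unitSphereArea n :=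
    Real.rpow_inv_natCast_pow (div_nonneg (hA₀.trans hA₁).le hω.le) hn0
  have area_iff : ∀ x, 0 < x → (unitSphereArea n * x ^ (n - 1) = A₁ ↔ x = r₁) := fun x hx => by
    rw [← pow_left_inj₀ hx.le hr₁nonneg hn0, hr₁pow, eq_div_iff hω.ne', mul_comm]
  have hlt : r₀ < r₁ := by
    rw [← pow_lt_pow_iff_left₀ hr₀pos.le hr₁nonneg hn0, hr₀pow, hr₁pow]
    gcongr
  -- The Lipschitz distance will be at most `2 log K = 2ε/3 < ε`.
  set K := Real.exp (ε / 3) with hK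
  have hK1 : 1 < K := Real.one_lt_exp_iff.2 (by positivity)
  -- The error of `areClose` as a function of `d = m / m₀ - 1`. It does not depend on `M`, so one
  -- `δ` serves all manifolds.
  set κ : ℝ → ℝ := fun d => (1 - √(1 - √d)) * (D + 2 * schwarzschildArclength n m₀ r₁)
    + schwarzschildArclength n m₀ ((1 + √d) ^ (((n : ℝ) - 2)⁻¹) * r₀) with hκ
  have hq : Tendsto (fun d : ℝ => √(1 - √d)) (𝓝[≥] 0) (𝓝 1) := by
    have hc : Continuous (fun d : ℝ => √(1 - √d)) := by fun_prop
    simpa using (hc.tendsto 0).mono_left (nhdsWithin_le_nhds (s := Ici 0))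
  have hκlim : Tendsto κ (𝓝[≥] 0) (𝓝 0) := by
    have := ((hq.const_sub 1).mul_const (D + 2 * schwarzschildArclength n m₀ r₁)).add
      (tendsto_schwarzschildArclength_matchingRadius hn hm₀pos)
    simpa using this
  have hev : ∀ᶠ d in 𝓝[≥] (0 : ℝ), 1 / 2 ≤ √(1 - √d) ∧
      (1 + √d) ^ (((n : ℝ) - 2)⁻¹) * r₀ < r₁ ∧ κ d < (K - 1) * D ∧ κ d < (K - 1) * r₀ / 2 := by
    have p1 : 0 < (K - 1) * D := mul_pos (by linarith) hD
    have p2 : 0 < (K - 1) * r₀ / 2 := half_pos (mul_pos (by linarith) hr₀pos)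
    filter_upwards [hq.eventually (lt_mem_nhds (by norm_num : (1 / 2 : ℝ) < 1)),
      (tendsto_matchingRadius m₀).eventually (gt_mem_nhds hlt),
      hκlim.eventually (gt_mem_nhds p1), hκlim.eventually (gt_mem_nhds p2)] with d h1 h2 h3 h4
    exact ⟨h1.le, h2, h3, h4⟩
  obtain ⟨δ, hδ, hsub⟩ := mem_nhdsGE_iff_exists_Ico_subset.1 hev
  refine ⟨δ, hδ, fun M m hM hm hmδ ⟨p, hp⟩ => ?_⟩
  have hmass : M.boundaryMass = m₀ := by rw [RotSymBdry.boundaryMass, hM]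
  have hr0 : M.r 0 = r₀ := by rw [← M.horizonRadius_boundaryMass hn, hmass]
  -- The Penrose inequality `m₀ ≤ m`, needed because the limits were taken from `d ≥ 0`.
  have hd0 : 0 ≤ m / m₀ - 1 := by
    have : M.boundaryMass ≤ m :=
      (M.boundaryMass_le_hawkingMass hn one_pos).trans (M.hawkingMass_le hn hm one_pos)
    rw [hmass] at this
    exact sub_nonneg.2 ((one_le_div hm₀pos).2 this)
  have hdδ : m / m₀ - 1 < δ := by
    rw [sub_lt_iff_lt_add, div_lt_iff₀ hm₀pos, hm₀]
    linarith
  obtain ⟨h1, h2, h3, h4⟩ := hsub ⟨hd0, hdδ⟩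
  have hs₁ : 0 ≤ p.1 := hp.1.1
  have hrs₁ : M.r p.1 = r₁ := (area_iff _ (M.pos _ hs₁)).1 hp.2
  have hmr : M.matchingRadius m = (1 + √(m / m₀ - 1)) ^ (((n : ℝ) - 2)⁻¹) * r₀ := by
    rw [RotSymBdry.matchingRadius, hmass, hr0]
  have hclose := M.areClose hn hm hs₁ hD (by rw [hmr, hrs₁]; exact h2) (by rw [hmass]; exact h1)
  rw [hmr, hrs₁, hmass] at hclose
  have hsph : M.space.symmetricSphere n A₁ = WarpedCylinder.strip n {p.1} :=
    WarpedCylinder.symmetricSphere_eq_strip hs₁ fun s hs => by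
      refine (area_iff _ (M.pos s hs)).trans ?_
      rw [← hrs₁]
      exact (M.strictMonoOn_r hn).injOn.eq_iff hs hs₁
  have hsph' : (appendedSchwarzschild n m₀ (M.depth m)).symmetricSphere n A₁
      = WarpedCylinder.strip n {schwarzschildArclength n m₀ r₁} := by
    -- The whole glued cylinder has radius `r₀ < r₁`, so the sphere of area `A₁` is unique and lies
    -- outside the horizon.
    have hpos : 0 < schwarzschildArclength n m₀ r₁ := by
      linarith [sub_le_schwarzschildArclength hn hm₀pos hlt.le]
    refine WarpedCylinder.symmetricSphere_eq_strip ?_ fun s _ => ?_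
    · have h5 := hclose.nonneg'
      have h6 : (appendedSchwarzschild n m₀ (M.depth m)).start = -M.depth m := rfl
      linarith
    · obtain ⟨h5, h6⟩ := appendedSchwarzschild_radius_spec hn hm₀pos (M.depth m) s
      refine (area_iff _ (hr₀pos.trans_le h5)).trans ⟨fun h => ?_, fun h => ?_⟩
      · rw [h] at h6
        rcases le_total s 0 with h7 | h7
        · rw [max_eq_right h7] at h6; linarith
        · rw [max_eq_left h7] at h6; exact h6.symm
      · rw [h]; exact appendedSchwarzschild_radius_arclength hn hm₀pos _ hlt.le
  rw [hmass, hsph, hsph']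
  have tame := M.space_isTame hn
  rw [hr0] at tame
  have hfin := hclose.lipDist_le (n := n) (by omega) (K := K) tame
    (appendedSchwarzschild_isTame hn hm₀pos _) hD
    (by
      have : κ (m / m₀ - 1) / D < K - 1 := (div_lt_iff₀ hD).2 h3
      linarith)
    (by
      have : 2 * κ (m / m₀ - 1) / r₀ < K - 1 := (div_lt_iff₀ hr₀pos).2 (by linarith)
      linarith)
  have hεlt : ENNReal.ofReal (2 * Real.log K) < ENNReal.ofReal ε := by
    rw [hK, Real.log_exp]
    exact (ENNReal.ofReal_lt_ofReal_iff hε).2 (by linarith)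
  exact ⟨hfin.1.trans_lt hεlt, hfin.2.trans_lt hεlt⟩
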